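/- Let $\mathfrak h$ be a finite-dimensional complex vector space and let $\Delta\subset\mathfrak h^*$ be a finite reduced crystallographic root system with coroots in $\mathfrak h$ ($\Delta$ need not span $\mathfrak h^*$); for example, $\Delta$ is the root system of a complex reductive Lie algebra with respect to a Cartan subalgebra $\mathfrak h$. Let $W$ be the Weyl group, $\Delta^+$ a positive system, $\Pi$ its set of simple roots and $S=\{s_\alpha\mid\alpha\in\Pi\}$, and let $\leqslant$ be the Bruhat order of the Coxeter system $(W,S)$. Let $\Theta\subsetneq\Pi$, let $\mathfrak a_\Theta=\{H\in\mathfrak h\mid\alpha(H)=0\ \text{for all}\ \alpha\in\Theta\}$, and let $w_\Theta$ be the longest element of $W_\Theta=\langle s_\beta\mid\beta\in\Theta\rangle$. For $\alpha\in\Delta$ let $\Delta(\alpha)$ be the set of all $\beta\in\Delta$ such that $\beta|_{\mathfrak a_\Theta}$ is a real multiple of $\alpha|_{\mathfrak a_\Theta}$; let $\Pi(\alpha)$ be the set of simple roots of the positive system $\Delta(\alpha)\cap\Delta^+$ of $\Delta(\alpha)$, let $w^\alpha$ be the longest element of the Weyl group $\langle s_\beta\mid\beta\in\Delta(\alpha)\rangle$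 of $\Delta(\alpha)$, and put $\sigma_\alpha=w^\alpha w_\Theta$. Let ${}^{ru}\Delta_\Theta^+$ be the set of all $\alpha\in\Delta^+$ such that $\sigma_\alpha$ has order two, $\alpha|_{\mathfrak a_\Theta}\neq0$ and $\Pi(\alpha)=\Theta\cup\{\alpha\}$. Their restrictions to $\mathfrak a_\Theta$ form a positive system of a reduced root system; let ${}^u\Pi_\Theta$ be its set of simple roots. Let $W(\Theta)'$ be the subgroup of $W$ generated by the $\sigma_\alpha$ with $\alpha\in{}^{ru}\Delta_\Theta^+$, let $S(\Theta)=\{\sigma_\alpha\mid\alpha\in{}^{ru}\Delta_\Theta^+,\ \alpha|_{\mathfrak a_\Theta}\in{}^u\Pi_\Theta\}$, and let $\leqslant_\Theta$ be the Bruhat order of the Coxeter system $(W(\Theta)',S(\Theta))$. Assume that $\Theta$ is seminormal, i.e. that there is a set $\Psi$ with $\Theta\subseteq\Psi\subseteq\Pi$ and ${}^u\Pi_\Theta=\{\alpha|_{\mathfrak a_\Theta}\mid\alpha\in\Psi\setminus\Theta\}$. Then for all $x,y\in W(\Theta)'$, we have $x\leqslant y$ if and only if $x\leqslant_\Theta y$.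 -/

import Mathlib

noncomputable section

/-! ### Lengths, longest elements and Bruhat orders for a group with a generating set -/

section CoxeterPair

variable {G : Type*} [Group G]

/-- The length of `w` with respect to the set `S`: the least `n` such that `w` is a product of
`n` elements of `S`. (In a Coxeter system the elements of `S` are involutions, so no inverses are
needed. The value is `0` by convention when `w` is not such a product.) -/
def wordLength (S : Set G) (w : G) : ℕ :=
  sInf {n | ∃ l : List G, (∀ s ∈ l, s ∈ S) ∧ l.prod = w ∧ l.length = n}

/-- `t` is a reflection of `(G, S)`: a conjugate, in `G`, of an element of `S`. -/
def IsReflectionOf (S : Set G) (t : G) : Prop :=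
  ∃ g : G, ∃ s ∈ S, t = g * s * g⁻¹

/-- The Bruhat order of a Coxeter system `(G, S)`: the reflexive and transitive closure of the
relation `u → u * t`, where `t` is a reflection and the length with respect to `S` increases. -/
def BruhatLE (S : Set G) : G → G → Prop :=
  Relation.ReflTransGen fun u v =>
    (∃ t, IsReflectionOf S t ∧ v = u * t) ∧ wordLength S u < wordLength S v

/-- `w` is an element of the subgroup `H` whose length with respect to `S` is maximal. -/
def IsLongestIn (H : Subgroup G) (S : Set G) (w : G) : Prop :=
  w ∈ H ∧ ∀ v ∈ H, wordLength S v ≤ wordLength S w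

/-- The longest element of `H` with respect to `S`. It is used only for finite Coxeter systems
`(H, S)`, where a longest element exists and is unique. -/
def longestElement (H : Subgroup G) (S : Set G) : G :=
  Classical.epsilon (IsLongestIn H S)

end CoxeterPair

/-! ### Useful roots -/

namespace UsefulRoots

/- `P` is a root system in `M = 𝔥*` with coroots in `N = 𝔥`, indexed by `ι`; `b` is a base (it
gives the simple roots `Π`, indexed by `b.support`, and the positive roots `Δ⁺`, singled out by
`b.IsPos`); `Θ` is a set of simple roots. All sets of roots are given as sets of indices. -/
variable {ι M N : Type*} [AddCommGroup M] [Module ℂ M] [AddCommGroup N] [Module ℂ N]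
  (P : RootPairing ι ℂ M N) (b : P.Base) (Θ : Set ι)

/-- The reflections `s_β`, for `β` in the set `Φ` of roots, as elements of the Weyl group. -/
def reflections (Φ : Set ι) : Set P.weylGroup :=
  RootPairing.weylGroup.ofIdx P '' Φ

/-- `𝔞_Θ = {H ∈ 𝔥 | α(H) = 0 for all α ∈ Θ}`. -/
def aSpace : Submodule ℂ N :=
  ⨅ i ∈ Θ, LinearMap.ker (P.root' i)

/-- The restriction `α|_{𝔞_Θ}` of the root `α`. -/
def restr (i : ι) : Module.Dual ℂ (aSpace P Θ) :=
  (P.root' i).domRestrict (aSpace P Θ)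

/-- `Δ(α)`: the roots whose restriction to `𝔞_Θ` is a real multiple of that of `α`. -/
def subDelta (i : ι) : Set ι :=
  {j | ∃ c : ℝ, restr P Θ j = (c : ℂ) • restr P Θ i}

/-- `Δ⁺(α) = Δ(α) ∩ Δ⁺`. -/
def subDeltaPos (i : ι) : Set ι :=
  {j ∈ subDelta P Θ i | b.IsPos j}

/-- `Π(α)`: the simple roots for `Δ⁺(α)`, i.e. the elements of `Δ⁺(α)` that are not the sum of
two elements of `Δ⁺(α)`. -/
def subPi (i : ι) : Set ι :=
  {j ∈ subDeltaPos P b Θ i |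
    ¬ ∃ k ∈ subDeltaPos P b Θ i, ∃ l ∈ subDeltaPos P b Θ i, P.root j = P.root k + P.root l}

/-- `w_Θ`: the longest element of the subgroup `W_Θ` generated by the `s_β`, `β ∈ Θ`. -/
def wTheta : P.weylGroup :=
  longestElement (Subgroup.closure (reflections P Θ)) (reflections P Θ)

/-- `w^α`: the longest element of the Weyl group `W_Θ(α)` of `Δ(α)`, with respect to the simple
roots `Π(α)`. -/
def wUpper (i : ι) : P.weylGroup :=
  longestElement (Subgroup.closure (reflections P (subDelta P Θ i)))
    (reflections P (subPi P b Θ i))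

/-- `σ_α = w^α w_Θ`. -/
def sigma (i : ι) : P.weylGroup :=
  wUpper P b Θ i * wTheta P Θ

/-- `α` is `Θ`-useful: `σ_α` has order two. -/
def IsUseful (i : ι) : Prop :=
  orderOf (sigma P b Θ i) = 2

/-- `α` is `Θ`-reduced: its restriction to `𝔞_Θ` is nonzero and `Π(α) = Θ ∪ {α}`. -/
def IsThetaReduced (i : ι) : Prop :=
  restr P Θ i ≠ 0 ∧ subPi P b Θ i = insert i Θ

/-- `{}^{ru}Δ_Θ⁺`: the positive roots that are `Θ`-useful and `Θ`-reduced. -/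
def ruDeltaPos : Set ι :=
  {i | b.IsPos i ∧ IsUseful P b Θ i ∧ IsThetaReduced P b Θ i}

/-- `{}^{ru}Σ_Θ⁺`: the restrictions to `𝔞_Θ` of the roots in `{}^{ru}Δ_Θ⁺`. -/
def ruSigmaPos : Set (Module.Dual ℂ (aSpace P Θ)) :=
  restr P Θ '' ruDeltaPos P b Θ

/-- `{}^uΠ_Θ`: the simple system of the positive system `{}^{ru}Σ_Θ⁺` of the reduced root system
`{}^{ru}Σ_Θ`, i.e. the elements of `{}^{ru}Σ_Θ⁺` that are not the sum of two elements of it. -/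
def uPi : Set (Module.Dual ℂ (aSpace P Θ)) :=
  {γ ∈ ruSigmaPos P b Θ |
    ¬ ∃ γ₁ ∈ ruSigmaPos P b Θ, ∃ γ₂ ∈ ruSigmaPos P b Θ, γ = γ₁ + γ₂}

/-- `W(Θ)'`: the subgroup of the Weyl group generated by the `σ_α`, `α ∈ {}^{ru}Δ_Θ⁺`. -/
def WPrime : Subgroup P.weylGroup :=
  Subgroup.closure (sigma P b Θ '' ruDeltaPos P b Θ)

/-- `S(Θ)`: the elements `σ_α` of `W(Θ)'`, for `α ∈ {}^{ru}Δ_Θ⁺` with restriction in `{}^uΠ_Θ`. -/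
def SPrime : Set (WPrime P b Θ) :=
  {w | ∃ i ∈ ruDeltaPos P b Θ, restr P Θ i ∈ uPi P b Θ ∧ (w : P.weylGroup) = sigma P b Θ i}

/-- `Θ ⊊ Π` is seminormal: there is `Ψ` with `Θ ⊆ Ψ ⊆ Π` such that `{}^uΠ_Θ` is the set of the
restrictions to `𝔞_Θ` of the elements of `Ψ - Θ`. -/
def IsSeminormal : Prop :=
  Θ ⊂ (b.support : Set ι) ∧
    ∃ Ψ : Set ι, Θ ⊆ Ψ ∧ Ψ ⊆ (b.support : Set ι) ∧ uPi P b Θ = restr P Θ '' (Ψ \ Θ)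

end UsefulRoots

end

/-!
The argument compares the two Bruhat orders through minimal coset representatives.

Seminormality forces the roots `α` defining `S(Θ)` to be the simple roots in `Ψ \ Θ` (`uBase_eq`).
Since `σ_α = w^α w_Θ` is an involution, its two factors commute, and it follows that `σ_α` permutes
the positive roots of the span of `Θ` (`sigma_mem_stab`); hence so does every `w` in `W(Θ)'`. Such a
`w` respects proportionality of restrictions to `𝔞_Θ`, so that the sign of `w γ`, for a positive
root `γ` in `Δ(α)` of nonzero restriction, is that of `w α`. Two consequences:

* `w α > 0` implies that `w` is of minimal length in its coset modulo the parabolic subgroup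
  generated by `s_β`, `β ∈ Θ ∪ {α}`, while `w σ_α` makes `α` negative if and only if `w α > 0`.
* If `w α > 0` and `σ_β w α < 0`, then `w α` lies in `Δ(β)`, and `w` carries the positive roots of
  `Δ(α)` to those of `Δ(β)`. By uniqueness of longest elements, `w σ_α w⁻¹ = σ_β`
  (`sigma_exchange`).

These sign rules are all that is needed to develop lengths, strong exchange and the lifting
properties of the Bruhat order for `(W(Θ)', S(Θ))`; this is done axiomatically for `IsSignSystem`,
which also covers `(W, S)` and the Weyl groups of the `Δ(α)`. That `S(Θ)` generates `W(Θ)'` follows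
by induction on the length in `W`: a nontrivial element of `W_Ψ` that permutes the positive roots of
the span of `Θ` makes some `α ∈ Ψ \ Θ` negative, and is shortened by `σ_α`
(`exists_mem_closure_of_mem_stab`).

The comparison `bruhatLE_coe_iff` is then an induction on `y`, along the steps `y → y σ_α` with
`y α > 0`. If `x ≤ y σ_α` in `W`, the minimal representative of the coset of `x`, which is `x` or
`x σ_α`, is below the minimal representative `y` (`bruhatLE_of_bruhatLE_mul_weyl`), so the inductive
hypothesis applies to it. In the other direction, right multiplication by `σ_α` is monotone below
`y` (`bruhatLE_mul_mul_weyl`).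
-/

noncomputable section

/-! ### Strong exchange and Bruhat order from a sign function -/

section SignSystem

variable {G I : Type*} [Group G]

/-- The involutions `s i` of a group `G` behave like simple reflections: `pos w i` plays the role of
`w αᵢ > 0`, and the last two fields say that `s i` changes the sign of `αᵢ`, and that `s j` changes
the sign of a positive `w αᵢ` only if `w αᵢ = αⱼ`, in the form `s j * w = w * s i`.
Conditions are imposed only on the subgroup generated by the `s i`, which may be smaller than
`G`. -/
structure IsSignSystem (s : I → G) (pos : G → I → Prop) : Prop where
  mul_self : ∀ i, s i * s i = 1
  pos_one : ∀ i, pos 1 i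
  pos_mul_self : ∀ w ∈ Subgroup.closure (Set.range s), ∀ i, pos (w * s i) i ↔ ¬ pos w i
  exchange : ∀ w ∈ Subgroup.closure (Set.range s), ∀ i j,
    pos w i → ¬ pos (s j * w) i → s j * w = w * s i

namespace IsSignSystem

variable {s : I → G} {pos : G → I → Prop} (h : IsSignSystem s pos)
include h

omit h in
lemma mem_closure (i : I) : s i ∈ Subgroup.closure (Set.range s) :=
  Subgroup.subset_closure ⟨i, rfl⟩

omit h in
lemma prod_mem (l : List I) : (l.map s).prod ∈ Subgroup.closure (Set.range s) := by
  refine Subgroup.list_prod_mem _ fun x hx ↦ ?_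
  obtain ⟨i, -, rfl⟩ := List.mem_map.mp hx
  exact Subgroup.subset_closure ⟨i, rfl⟩

lemma mul_mul_self (w : G) (i : I) : w * s i * s i = w := by
  rw [mul_assoc, h.mul_self, mul_one]

lemma inv_eq (i : I) : (s i)⁻¹ = s i := inv_eq_of_mul_eq_one_left (h.mul_self i)

lemma exists_word {w : G} (hw : w ∈ Subgroup.closure (Set.range s)) :
    ∃ l : List I, (l.map s).prod = w := by
  induction hw using Subgroup.closure_induction_right with
  | one => exact ⟨[], rfl⟩
  | mul_right x hx y hy ih =>
    obtain ⟨l, rfl⟩ := ih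
    obtain ⟨i, rfl⟩ := hy
    exact ⟨l ++ [i], by simp⟩
  | mul_inv_cancel x hx y hy ih =>
    obtain ⟨l, rfl⟩ := ih
    obtain ⟨i, rfl⟩ := hy
    exact ⟨l ++ [i], by simp [h.inv_eq]⟩

omit h in
lemma wordLength_le (l : List I) : wordLength (Set.range s) (l.map s).prod ≤ l.length :=
  Nat.sInf_le ⟨l.map s, by simp, rfl, by simp⟩

lemma exists_reduced_word {w : G} (hw : w ∈ Subgroup.closure (Set.range s)) :
    ∃ l : List I, (l.map s).prod = w ∧ l.length = wordLength (Set.range s) w := by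
  obtain ⟨l₀, hl₀⟩ := h.exists_word hw
  obtain ⟨l, hl, hlw, hlen⟩ := Nat.sInf_mem (s := {n | ∃ l : List G,
    (∀ x ∈ l, x ∈ Set.range s) ∧ l.prod = w ∧ l.length = n}) ⟨_, l₀.map s, by simp, hl₀, rfl⟩
  obtain ⟨l, rfl⟩ : l ∈ Set.range (List.map s) := by rw [Set.range_list_map]; exact hl
  exact ⟨l, hlw, by simpa [wordLength] using hlen⟩

lemma exchange_ne {w : G} (hw : w ∈ Subgroup.closure (Set.range s)) {i j : I}
    (hne : ¬ (pos (s j * w) i ↔ pos w i)) : s j * w = w * s i := by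
  by_cases hp : pos w i
  · exact h.exchange w hw i j hp fun hq ↦ hne ⟨fun _ ↦ hp, fun _ ↦ hq⟩
  · have hq : pos (s j * w) i := by tauto
    have := h.exchange (s j * w) (mul_mem (mem_closure j) hw) i j hq
      (by rwa [← mul_assoc, h.mul_self, one_mul])
    rw [← mul_assoc, h.mul_self, one_mul] at this
    calc s j * w = s j * w * s i * s i := (h.mul_mul_self _ i).symm
      _ = w * s i := by rw [← this]

/-- The strong exchange property: if the reflection in `g αᵢ` is an inversion of the product of a
word (the sign of `g αᵢ` is changed), then multiplying by it amounts to deleting a letter. -/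
lemma exists_eraseIdx (l : List I) {g : G} (hg : g ∈ Subgroup.closure (Set.range s)) {i : I}
    (hne : ¬ (pos ((l.map s).prod * g) i ↔ pos g i)) :
    ∃ k < l.length, (l.map s).prod * (g * s i * g⁻¹) = ((l.eraseIdx k).map s).prod := by
  induction l with
  | nil => simp at hne
  | cons j l ih =>
    by_cases hl : pos ((l.map s).prod * g) i ↔ pos g i
    · refine ⟨0, by simp, ?_⟩
      have := h.exchange_ne (w := (l.map s).prod * g) (mul_mem (prod_mem l) hg) (i := i) (j := j)
        (by rwa [hl, ← mul_assoc, ← List.prod_cons, ← List.map_cons])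
      have key : (l.map s).prod * (g * s i * g⁻¹) = s j * (l.map s).prod := by
        rw [← mul_assoc, ← mul_assoc, ← this]; group
      simp [mul_assoc (s j), key]
      rw [← mul_assoc, h.mul_self, one_mul]
    · obtain ⟨k, hk, hkl⟩ := ih hl
      exact ⟨k + 1, by simpa, by simp [mul_assoc (s j), hkl]⟩

lemma wordLength_mul_lt {w g : G} (hw : w ∈ Subgroup.closure (Set.range s))
    (hg : g ∈ Subgroup.closure (Set.range s)) {i : I} (hne : ¬ (pos (w * g) i ↔ pos g i)) :
    wordLength (Set.range s) (w * (g * s i * g⁻¹)) < wordLength (Set.range s) w := by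
  obtain ⟨l, rfl, hl⟩ := h.exists_reduced_word hw
  obtain ⟨k, hk, hkl⟩ := h.exists_eraseIdx l hg hne
  rw [hkl, ← hl]
  refine (wordLength_le _).trans_lt ?_
  rw [List.length_eraseIdx_of_lt hk]
  omega

lemma wordLength_lt_mul {w g : G} (hw : w ∈ Subgroup.closure (Set.range s))
    (hg : g ∈ Subgroup.closure (Set.range s)) {i : I} (heq : pos (w * g) i ↔ pos g i) :
    wordLength (Set.range s) w < wordLength (Set.range s) (w * (g * s i * g⁻¹)) := by
  have hmem : g * s i * g⁻¹ ∈ Subgroup.closure (Set.range s) :=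
    mul_mem (mul_mem hg (mem_closure i)) (inv_mem hg)
  have := h.wordLength_mul_lt (mul_mem hw hmem) hg (i := i) (by
    have e : w * (g * s i * g⁻¹) * g = w * g * s i := by group
    rw [e, h.pos_mul_self _ (mul_mem hw hg), heq]
    tauto)
  have e : w * (g * s i * g⁻¹) * (g * s i * g⁻¹) = w := by
    have : w * (g * s i * g⁻¹) * (g * s i * g⁻¹) = w * g * (s i * s i) * g⁻¹ := by group
    rw [this, h.mul_self]; group
  rwa [e] at this

lemma wordLength_lt_mul_iff {w : G} (hw : w ∈ Subgroup.closure (Set.range s)) {i : I} :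
    wordLength (Set.range s) w < wordLength (Set.range s) (w * s i) ↔ pos w i := by
  have h1 := h.pos_one i
  constructor
  · intro hlt
    by_contra hp
    have := h.wordLength_mul_lt hw (one_mem _) (i := i) (by simpa [h1] using hp)
    simp at this
    omega
  · intro hp
    simpa using h.wordLength_lt_mul hw (one_mem _) (i := i) (by simpa [h1] using hp)

lemma wordLength_mul_lt_iff {w : G} (hw : w ∈ Subgroup.closure (Set.range s)) {i : I} :
    wordLength (Set.range s) (w * s i) < wordLength (Set.range s) w ↔ ¬ pos w i := by
  rw [← h.pos_mul_self w hw, ← h.wordLength_lt_mul_iff (mul_mem hw (mem_closure i)),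
    h.mul_mul_self]

lemma exchange_of_lt {l : List I} {g : G} (hg : g ∈ Subgroup.closure (Set.range s)) {i : I}
    (hlt : wordLength (Set.range s) ((l.map s).prod * (g * s i * g⁻¹)) <
      wordLength (Set.range s) (l.map s).prod) :
    ∃ k < l.length, (l.map s).prod * (g * s i * g⁻¹) = ((l.eraseIdx k).map s).prod :=
  h.exists_eraseIdx l hg fun heq ↦ hlt.asymm (h.wordLength_lt_mul (prod_mem l) hg heq)

lemma wordLength_mul_le {w : G} (hw : w ∈ Subgroup.closure (Set.range s)) (i : I) :
    wordLength (Set.range s) (w * s i) ≤ wordLength (Set.range s) w + 1 := by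
  obtain ⟨l, rfl, hl⟩ := h.exists_reduced_word hw
  simpa [hl] using wordLength_le (s := s) (l ++ [i])

lemma eq_one_of_wordLength_eq_zero {w : G} (hw : w ∈ Subgroup.closure (Set.range s))
    (h0 : wordLength (Set.range s) w = 0) : w = 1 := by
  obtain ⟨l, rfl, hl⟩ := h.exists_reduced_word hw
  rw [h0, List.length_eq_zero_iff] at hl
  simp [hl]

omit h in
lemma wordLength_one : wordLength (Set.range s) 1 = 0 := by
  simpa using wordLength_le (s := s) []

lemma eq_one_of_forall_pos {w : G} (hw : w ∈ Subgroup.closure (Set.range s))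
    (hpos : ∀ i, pos w i) : w = 1 := by
  obtain ⟨l, rfl, hl⟩ := h.exists_reduced_word hw
  rcases List.eq_nil_or_concat l with rfl | ⟨l, i, rfl⟩
  · simp
  · have hlt := (h.wordLength_lt_mul_iff (prod_mem l)).not.mpr fun hp ↦
      (h.pos_mul_self _ (prod_mem l) i).mp (by simpa using hpos i) hp
    have := wordLength_le (s := s) l
    simp at hl hlt
    omega

/-- Induction along reduced words. -/
lemma induction {p : G → Prop} (one : p 1)
    (mul : ∀ w ∈ Subgroup.closure (Set.range s), ∀ i, pos w i → p w → p (w * s i))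
    {w : G} (hw : w ∈ Subgroup.closure (Set.range s)) : p w := by
  induction hn : wordLength (Set.range s) w using Nat.strong_induction_on generalizing w with
  | _ n ih =>
    by_cases hp : ∀ i, pos w i
    · rwa [h.eq_one_of_forall_pos hw hp]
    · push Not at hp
      obtain ⟨i, hi⟩ := hp
      have hwi := mul_mem hw (mem_closure i)
      rw [← h.mul_mul_self w i]
      exact mul _ hwi i ((h.pos_mul_self w hw i).mpr hi)
        (ih _ (hn ▸ (h.wordLength_mul_lt_iff hw).mpr hi) hwi rfl)

end IsSignSystem

end SignSystem

section Bruhat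

variable {G : Type*} [Group G] {S : Set G} {x y z : G}

lemma BruhatLE.refl (x : G) : BruhatLE S x x := Relation.ReflTransGen.refl

lemma BruhatLE.trans (hxy : BruhatLE S x y) (hyz : BruhatLE S y z) : BruhatLE S x z :=
  Relation.ReflTransGen.trans hxy hyz

lemma BruhatLE.wordLength_le (hxy : BruhatLE S x y) : wordLength S x ≤ wordLength S y := by
  induction hxy with
  | refl => rfl
  | tail _ h ih => exact ih.trans h.2.le

namespace IsSignSystem

variable {I : Type*} {s : I → G} {pos : G → I → Prop} (h : IsSignSystem s pos)
  (htop : Subgroup.closure (Set.range s) = ⊤)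
include h htop

lemma bruhatLE_mul_self (i : I) (hp : pos x i) : BruhatLE (Set.range s) x (x * s i) :=
  .single ⟨⟨s i, ⟨1, s i, ⟨i, rfl⟩, by simp⟩, rfl⟩,
    (h.wordLength_lt_mul_iff (htop ▸ Subgroup.mem_top x)).mpr hp⟩

lemma eq_one_of_bruhatLE_one (hx : BruhatLE (Set.range s) x 1) : x = 1 := by
  refine h.eq_one_of_wordLength_eq_zero (htop ▸ Subgroup.mem_top x) ?_
  simpa [wordLength_one] using hx.wordLength_le

/-- A step `u → v` of the Bruhat order, multiplied by a simple reflection, is again a step unless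
the two elements are interchanged. -/
lemma cover_mul_self {u v : G} (i : I)
    (huv : (∃ t, IsReflectionOf (Set.range s) t ∧ v = u * t) ∧
      wordLength (Set.range s) u < wordLength (Set.range s) v) :
    u * s i = v ∨ BruhatLE (Set.range s) (u * s i) (v * s i) := by
  have mem (g : G) : g ∈ Subgroup.closure (Set.range s) := htop ▸ Subgroup.mem_top g
  obtain ⟨⟨t, ⟨g, _, ⟨j, rfl⟩, rfl⟩, rfl⟩, hlt⟩ := huv
  by_cases hv : u * s i = u * (g * s j * g⁻¹)
  · exact .inl hv
  right
  have e : u * (g * s j * g⁻¹) * s i = u * s i * ((s i * g) * s j * (s i * g)⁻¹) := by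
    have e1 : u * s i * ((s i * g) * s j * (s i * g)⁻¹) =
      u * (s i * s i) * (g * s j * g⁻¹) * (s i)⁻¹ := by group
    rw [e1, h.mul_self, h.inv_eq, mul_one]
  refine .single ⟨⟨(s i * g) * s j * (s i * g)⁻¹, ⟨_, _, ⟨j, rfl⟩, rfl⟩, e⟩, ?_⟩
  rw [e]
  refine h.wordLength_lt_mul (mem _) (mem _) ?_
  by_contra hne
  have hlt' := h.wordLength_mul_lt (mem _) (mem _) hne
  rw [← e] at hlt'
  set v := u * (g * s j * g⁻¹) with hvdef
  have h1 : wordLength (Set.range s) v ≤ wordLength (Set.range s) (v * s i) + 1 := by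
    simpa [h.mul_mul_self] using h.wordLength_mul_le (mem (v * s i)) i
  obtain ⟨l, hl, hlen⟩ := h.exists_reduced_word (mem u)
  obtain ⟨k, hk, hkl⟩ := h.exchange_of_lt (l := l ++ [i]) (mem (s i * g)) (i := j) (by
    have e2 : ((l ++ [i]).map s).prod = u * s i := by simp [hl]
    rwa [e2, ← e])
  simp only [List.map_append, hl, List.map_cons, List.map_nil, List.prod_append, List.prod_cons,
    List.prod_nil, mul_one, ← e] at hkl
  rcases Nat.lt_or_ge k l.length with hk' | hk'
  · -- the deleted letter belongs to the word of `u`, so `v` would be shorter than `u`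
    rw [List.eraseIdx_append_of_lt_length hk'] at hkl
    simp only [List.map_append, List.map_cons, List.map_nil, List.prod_append, List.prod_cons,
      List.prod_nil, mul_one, mul_left_inj] at hkl
    have := wordLength_le (s := s) (l.eraseIdx k)
    rw [← hkl, List.length_eraseIdx_of_lt hk'] at this
    omega
  · -- the deleted letter is the last one, so `v * s i = u`
    obtain rfl : k = l.length := by simp at hk; omega
    simp [List.eraseIdx_append_of_length_le, hl] at hkl
    exact hv (by rw [← hkl, h.mul_mul_self])

lemma bruhatLE_or_of_bruhatLE (i : I) (hxy : BruhatLE (Set.range s) x y) :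
    BruhatLE (Set.range s) x (y * s i) ∨ BruhatLE (Set.range s) (x * s i) (y * s i) := by
  induction hxy using Relation.ReflTransGen.head_induction_on with
  | refl => exact .inr (.refl _)
  | head hab _ ih =>
    rcases ih with ih | ih
    · exact .inl (.head hab ih)
    · rcases h.cover_mul_self htop i hab with rfl | hab'
      · exact .inl (by rwa [h.mul_mul_self] at ih)
      · exact .inr (hab'.trans ih)

lemma mul_self_bruhatLE_or (i : I) (hxy : BruhatLE (Set.range s) x y) :
    BruhatLE (Set.range s) (x * s i) y ∨ BruhatLE (Set.range s) (x * s i) (y * s i) := by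
  induction hxy using Relation.ReflTransGen.head_induction_on with
  | refl => exact .inr (.refl _)
  | head hab hby ih =>
    rcases h.cover_mul_self htop i hab with rfl | hab'
    · exact .inl hby
    · exact ih.imp hab'.trans hab'.trans

lemma bruhatLE_mul_mul (i : I) (hxy : BruhatLE (Set.range s) x y) (hp : pos y i) :
    BruhatLE (Set.range s) (x * s i) (y * s i) :=
  (h.mul_self_bruhatLE_or htop i hxy).elim (·.trans (h.bruhatLE_mul_self htop i hp)) id

lemma bruhatLE_of_bruhatLE_mul (i : I) (hxy : BruhatLE (Set.range s) x (y * s i))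
    (hp : pos x i) : BruhatLE (Set.range s) x y := by
  have := h.bruhatLE_or_of_bruhatLE htop i hxy
  rw [h.mul_mul_self] at this
  exact this.elim id ((h.bruhatLE_mul_self htop i hp).trans ·)

end IsSignSystem

end Bruhat

namespace UsefulRoots

/-! ### Subsystems of a root system and their longest elements -/

section Subsystems

variable {ι M N : Type*} [AddCommGroup M] [Module ℂ M] [AddCommGroup N] [Module ℂ N]
  {P : RootPairing ι ℂ M N}

open RootPairing

/-- The index of the root `-α`, where `i` is the index of `α`. -/
def negIdx (P : RootPairing ι ℂ M N) (i : ι) : ι := P.reflectionPerm i i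

@[simp] lemma root_negIdx (i : ι) : P.root (negIdx P i) = -P.root i := by
  simp [negIdx]

@[simp] lemma negIdx_negIdx (i : ι) : negIdx P (negIdx P i) = i :=
  P.root.injective (by simp)

lemma isPos_negIdx (b : P.Base) (i : ι) : b.IsPos (negIdx P i) ↔ ¬ b.IsPos i :=
  Base.IsPos.neg_iff_not b i

lemma root_smul (w : P.weylGroup) (i : ι) : P.root (w • i) = w • P.root i :=
  (weylGroup_apply_root P w i).symm

lemma smul_negIdx (w : P.weylGroup) (i : ι) : w • negIdx P i = negIdx P (w • i) :=
  P.root.injective (by simp [root_smul])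

lemma ofIdx_smul_self (i : ι) : weylGroup.ofIdx P i • i = negIdx P i := rfl

lemma root_ofIdx_smul [P.IsCrystallographic] (i j : ι) :
    P.root (weylGroup.ofIdx P j • i) = P.root i - P.pairingIn ℤ i j • P.root j := by
  rw [root_smul, weylGroup.ofIdx_smul, Equiv.reflection_smul, reflection_apply_root' ℤ]

lemma ofIdx_mul_self (i : ι) : weylGroup.ofIdx P i * weylGroup.ofIdx P i = 1 := by
  have : (weylGroup.ofIdx P i)⁻¹ = weylGroup.ofIdx P i := Subtype.ext (Equiv.reflection_inv P i)
  rw [mul_eq_one_iff_inv_eq, this]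

lemma ofIdx_smul_eq_conj (w : P.weylGroup) (i : ι) :
    weylGroup.ofIdx P (w • i) = w * weylGroup.ofIdx P i * w⁻¹ := by
  obtain ⟨w, hw⟩ := w
  induction hw using weylGroup.induction generalizing i with
  | mem j =>
    refine Subtype.ext (Equiv.weightHom_injective P ?_)
    change Equiv.weightHom P (Equiv.reflection P (P.reflectionPerm j i)) =
      Equiv.weightHom P (Equiv.reflection P j * Equiv.reflection P i * (Equiv.reflection P j)⁻¹)
    simp [reflection_reflectionPerm]
    rfl
  | one =>
    change weylGroup.ofIdx P ((1 : P.weylGroup) • i) = 1 * _ * 1⁻¹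
    simp
  | mul x y hx hy ihx ihy =>
    have e : (⟨x * y, mul_mem hx hy⟩ : P.weylGroup) = ⟨x, hx⟩ * ⟨y, hy⟩ := rfl
    rw [e, mul_smul, ihx, ihy]
    group

/-- A set of roots, given by indices, containing every root `α + zβ` with `α`, `β` in the set and
`z` an integer; such a set is a root subsystem that is stable under addition and negation. -/
def IsSubsystem (P : RootPairing ι ℂ M N) (Φ : Set ι) : Prop :=
  ∀ i ∈ Φ, ∀ j ∈ Φ, ∀ (z : ℤ) (k : ι), P.root k = P.root i + z • P.root j → k ∈ Φ

/-- The positive roots belonging to `Φ`. -/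
def posPart (b : P.Base) (Φ : Set ι) : Set ι := {j ∈ Φ | b.IsPos j}

/-- The simple roots of the positive system `posPart b Φ`: its indecomposable elements. -/
def simples (b : P.Base) (Φ : Set ι) : Set ι :=
  {j ∈ posPart b Φ | ¬ ∃ k ∈ posPart b Φ, ∃ l ∈ posPart b Φ, P.root j = P.root k + P.root l}

/-- The Weyl group of `Φ`, generated by the reflections in its simple roots. -/
def weyl (b : P.Base) (Φ : Set ι) : Subgroup P.weylGroup :=
  Subgroup.closure (reflections P (simples b Φ))

/-- The longest element of the Weyl group of `Φ`. -/
def longest (b : P.Base) (Φ : Set ι) : P.weylGroup :=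
  longestElement (weyl b Φ) (reflections P (simples b Φ))

variable {Φ : Set ι} (b : P.Base)

namespace IsSubsystem

lemma negIdx_mem (hΦ : IsSubsystem P Φ) {i : ι} (hi : i ∈ Φ) : negIdx P i ∈ Φ :=
  hΦ i hi i hi (-2) _ (by rw [root_negIdx]; module)

lemma sub_mem (hΦ : IsSubsystem P Φ) {i j k : ι} (hi : i ∈ Φ) (hj : j ∈ Φ)
    (hk : P.root k = P.root i - P.root j) : k ∈ Φ :=
  hΦ i hi j hj (-1) k (by simpa [sub_eq_add_neg] using hk)

lemma ofIdx_smul_mem [P.IsCrystallographic] (hΦ : IsSubsystem P Φ) {i j : ι} (hi : i ∈ Φ)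
    (hj : j ∈ Φ) : weylGroup.ofIdx P j • i ∈ Φ :=
  hΦ i hi j hj (-P.pairingIn ℤ i j) _ (by rw [root_ofIdx_smul]; module)

lemma smul_mem [P.IsCrystallographic] (hΦ : IsSubsystem P Φ) {X : Set ι} (hX : X ⊆ Φ)
    {w : P.weylGroup} (hw : w ∈ Subgroup.closure (reflections P X)) {i : ι} :
    w • i ∈ Φ ↔ i ∈ Φ := by
  induction hw using Subgroup.closure_induction generalizing i with
  | mem x hx =>
    obtain ⟨j, hj, rfl⟩ := hx
    refine ⟨fun h ↦ ?_, fun h ↦ hΦ.ofIdx_smul_mem h (hX hj)⟩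
    have := hΦ.ofIdx_smul_mem h (hX hj)
    rwa [← mul_smul, ofIdx_mul_self, one_smul] at this
  | one => simp
  | mul x y _ _ hx hy => rw [mul_smul, hx, hy]
  | inv x _ hx => rw [← hx, smul_inv_smul]

end IsSubsystem

lemma neg_mem_posPart (hΦ : IsSubsystem P Φ) {i : ι} (hi : i ∈ Φ) (hn : ¬ b.IsPos i) :
    negIdx P i ∈ posPart b Φ :=
  ⟨hΦ.negIdx_mem hi, (isPos_negIdx b i).mpr hn⟩

/-- Every positive root of `Φ` is a sum of simple roots of `Φ`, as a principle of induction. -/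
lemma posPart_induction {p : ι → Prop} (simple : ∀ i ∈ simples b Φ, p i)
    (add : ∀ i ∈ posPart b Φ, ∀ j ∈ posPart b Φ, ∀ k, P.root k = P.root i + P.root j →
      p i → p j → p k) {i : ι} (hi : i ∈ posPart b Φ) : p i := by
  induction hn : (b.height i).toNat using Nat.strong_induction_on generalizing i with
  | _ n ih =>
    by_cases hs : i ∈ simples b Φ
    · exact simple i hs
    · obtain ⟨k, hk, l, hl, hkl⟩ : ∃ k ∈ posPart b Φ, ∃ l ∈ posPart b Φ,
          P.root i = P.root k + P.root l := by
        by_contra hne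
        exact hs ⟨hi, hne⟩
      have hh := b.height_add hkl
      have hk0 := (b.isPos_iff).mp hk.2
      have hl0 := (b.isPos_iff).mp hl.2
      exact add k hk l hl i hkl (ih _ (by omega) hk rfl) (ih _ (by omega) hl rfl)

lemma smul_not_isPos_of_simples {w : P.weylGroup} (h : ∀ j ∈ simples b Φ, ¬ b.IsPos (w • j))
    {i : ι} (hi : i ∈ posPart b Φ) : ¬ b.IsPos (w • i) := by
  refine posPart_induction b h (fun i _ j _ k hk hi hj ↦ ?_) hi
  rw [← isPos_negIdx] at hi hj ⊢
  exact hi.add hj (by simp [root_smul, hk]; abel)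

variable [Finite ι] [P.IsCrystallographic] [P.IsReduced]

/-- A simple reflection of `Φ` permutes the positive roots of `Φ` other than its own root. The
simple roots of `Φ` need not be simple in the ambient root system; only their indecomposability
is used. -/
lemma smul_mem_posPart_of_ne (hΦ : IsSubsystem P Φ) {j : ι} (hj : j ∈ simples b Φ) {i : ι}
    (hi : i ∈ posPart b Φ) (hij : i ≠ j) : weylGroup.ofIdx P j • i ∈ posPart b Φ := by
  induction hn : (b.height i).toNat using Nat.strong_induction_on generalizing i with
  | _ n ih =>
    refine ⟨hΦ.ofIdx_smul_mem hi.1 hj.1.1, ?_⟩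
    have hroot := root_ofIdx_smul (P := P) i j
    have hi0 := (b.isPos_iff).mp hi.2
    have hj0 := (b.isPos_iff).mp hj.1.2
    rcases le_or_gt (P.pairingIn ℤ i j) 0 with hc | hc
    · rw [sub_eq_add_neg, ← neg_smul] at hroot
      rw [b.isPos_iff, b.height_add_zsmul hroot, smul_eq_mul]
      nlinarith
    · -- both `k = i - j` and `s_j i = s_j k - j` are positive, as `j` would be a sum otherwise
      obtain ⟨k, hk⟩ := P.root_sub_root_mem_of_pairingIn_pos hc hij
      have hkΦ : k ∈ Φ := hΦ.sub_mem hi.1 hj.1.1 hk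
      have hkpos : k ∈ posPart b Φ := by
        by_contra hneg
        exact hj.2 ⟨i, hi, negIdx P k, neg_mem_posPart b hΦ hkΦ fun h ↦ hneg ⟨hkΦ, h⟩,
          by rw [root_negIdx, hk]; abel⟩
      have hkj : k ≠ j := by
        rintro rfl
        have : IsAddTorsionFree M := .of_isTorsionFree ℂ M
        exact P.nsmul_notMem_range_root (n := 2) (i := k) ⟨i, by
          rw [eq_sub_iff_add_eq] at hk; rw [← hk, two_smul]⟩
      have hk' := ih _ (by have := b.height_sub hk; omega) hkpos hkj rfl
      by_contra hneg
      refine hj.2 ⟨_, hk', _, neg_mem_posPart b hΦ (hΦ.ofIdx_smul_mem hi.1 hj.1.1) hneg, ?_⟩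
      rw [root_negIdx, root_smul _ k, hk, smul_sub, ← root_smul, ← root_smul, ofIdx_smul_self,
        root_negIdx]
      abel

omit [Finite ι] [P.IsCrystallographic] [P.IsReduced] in
lemma range_ofIdx_simples :
    Set.range (fun j : simples b Φ ↦ weylGroup.ofIdx P (j : ι)) = reflections P (simples b Φ) :=
  (Set.image_eq_range _ _).symm

omit [Finite ι] [P.IsCrystallographic] [P.IsReduced] in
lemma simples_subset : simples b Φ ⊆ Φ := fun _ h ↦ h.1.1

omit [Finite ι] [P.IsReduced] in
lemma smul_mem_iff (hΦ : IsSubsystem P Φ) {w : P.weylGroup} (hw : w ∈ weyl b Φ) {i : ι} :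
    w • i ∈ Φ ↔ i ∈ Φ :=
  hΦ.smul_mem (simples_subset b) hw

/-- The Weyl group of a subsystem, with its simple reflections, acting on roots. -/
lemma isSignSystem (hΦ : IsSubsystem P Φ) :
    IsSignSystem (fun j : simples b Φ ↦ weylGroup.ofIdx P (j : ι))
      (fun w j ↦ b.IsPos (w • (j : ι))) where
  mul_self _ := ofIdx_mul_self _
  pos_one j := by simpa using j.2.1.2
  pos_mul_self w _ j := by rw [mul_smul, ofIdx_smul_self, smul_negIdx, isPos_negIdx]
  exchange w hw i j hp hn := by
    rw [range_ofIdx_simples] at hw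
    have hmem : w • (i : ι) ∈ posPart b Φ := ⟨(smul_mem_iff b hΦ hw).mpr i.2.1.1, hp⟩
    have : w • (i : ι) = j := by
      by_contra hne
      exact hn (by rw [mul_smul]; exact (smul_mem_posPart_of_ne b hΦ j.2 hmem hne).2)
    rw [← this, ofIdx_smul_eq_conj]
    group

lemma eq_one_of_smul_isPos (hΦ : IsSubsystem P Φ) {w : P.weylGroup} (hw : w ∈ weyl b Φ)
    (h : ∀ j ∈ simples b Φ, b.IsPos (w • j)) : w = 1 :=
  (isSignSystem b hΦ).eq_one_of_forall_pos (by rwa [range_ofIdx_simples]) fun j ↦ h j j.2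

/-- An element of `W_Φ` is determined by the property of making all positive roots of `Φ`
negative. -/
lemma eq_of_smul_not_isPos (hΦ : IsSubsystem P Φ) {u v : P.weylGroup} (hu : u ∈ weyl b Φ)
    (hv : v ∈ weyl b Φ) (hu' : ∀ j ∈ posPart b Φ, ¬ b.IsPos (u • j))
    (hv' : ∀ j ∈ posPart b Φ, ¬ b.IsPos (v • j)) : u = v := by
  rw [← inv_mul_eq_one]
  refine eq_one_of_smul_isPos b hΦ (mul_mem (inv_mem hu) hv) fun j hj ↦ ?_
  by_contra hn
  have hmem := (smul_mem_iff b hΦ (mul_mem (inv_mem hu) hv)).mpr hj.1.1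
  have := hu' _ (neg_mem_posPart b hΦ hmem hn)
  rw [smul_negIdx, isPos_negIdx, not_not, smul_smul, mul_inv_cancel_left] at this
  exact hv' j hj.1 this

omit [Finite ι] [P.IsReduced] in
/-- Otherwise all positive roots, being sums of simple ones, would pair nonpositively with the
coroot of `i`, including `i` itself. -/
lemma exists_simple_pairingIn_pos {i : ι} (hi : i ∈ posPart b Φ) :
    ∃ j ∈ simples b Φ, 0 < P.pairingIn ℤ j i := by
  by_contra! hne
  have : P.pairingIn ℤ i i ≤ 0 := by
    refine posPart_induction (p := fun j ↦ P.pairingIn ℤ j i ≤ 0) b hne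
      (fun k _ l _ m hm hk hl ↦ ?_) hi
    rw [P.pairingIn_eq_add_of_root_eq_add hm]
    omega
  simp at this

lemma ofIdx_mem_weyl_of_mem_posPart (hΦ : IsSubsystem P Φ) {i : ι} (hi : i ∈ posPart b Φ) :
    weylGroup.ofIdx P i ∈ weyl b Φ := by
  induction hn : (b.height i).toNat using Nat.strong_induction_on generalizing i with
  | _ n ih =>
    obtain ⟨j, hj, hji⟩ := exists_simple_pairingIn_pos b hi
    have hjW : weylGroup.ofIdx P j ∈ weyl b Φ := Subgroup.subset_closure ⟨j, hj, rfl⟩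
    rw [P.zero_lt_pairingIn_iff'] at hji
    rcases eq_or_ne i j with rfl | hij
    · exact hjW
    have hk := smul_mem_posPart_of_ne b hΦ hj hi hij
    have hroot := root_ofIdx_smul (P := P) i j
    rw [sub_eq_add_neg, ← neg_smul] at hroot
    have hh := b.height_add_zsmul hroot
    rw [smul_eq_mul] at hh
    have hj0 := (b.isPos_iff).mp hj.1.2
    have hi0 := (b.isPos_iff).mp hi.2
    have := ih _ (by have : 0 < P.pairingIn ℤ i j * b.height j := by positivity
                     rw [neg_mul] at hh; omega) hk rfl
    rw [ofIdx_smul_eq_conj] at this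
    simpa [mul_assoc] using mul_mem (mul_mem (inv_mem hjW) this) hjW

omit [Finite ι] [P.IsCrystallographic] [P.IsReduced] in
lemma ofIdx_negIdx (i : ι) : weylGroup.ofIdx P (negIdx P i) = weylGroup.ofIdx P i := by
  rw [← ofIdx_smul_self, ofIdx_smul_eq_conj]; group

lemma ofIdx_mem_weyl (hΦ : IsSubsystem P Φ) {i : ι} (hi : i ∈ Φ) :
    weylGroup.ofIdx P i ∈ weyl b Φ := by
  by_cases hp : b.IsPos i
  · exact ofIdx_mem_weyl_of_mem_posPart b hΦ ⟨hi, hp⟩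
  · rw [← ofIdx_negIdx]
    exact ofIdx_mem_weyl_of_mem_posPart b hΦ (neg_mem_posPart b hΦ hi hp)

lemma closure_reflections (hΦ : IsSubsystem P Φ) :
    Subgroup.closure (reflections P Φ) = weyl b Φ := by
  refine le_antisymm ?_ (Subgroup.closure_mono (Set.image_mono (simples_subset b)))
  rw [Subgroup.closure_le]
  rintro _ ⟨i, hi, rfl⟩
  exact ofIdx_mem_weyl b hΦ hi

lemma weyl_univ (b : P.Base) : weyl b (Set.univ : Set ι) = ⊤ := by
  rw [← closure_reflections b (fun _ _ _ _ _ _ _ ↦ Set.mem_univ _), eq_top_iff]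
  rintro ⟨w, hw⟩ -
  induction hw using weylGroup.induction with
  | mem i => exact Subgroup.subset_closure ⟨i, Set.mem_univ _, rfl⟩
  | one => exact one_mem _
  | mul x y hx hy ihx ihy => exact mul_mem ihx ihy

lemma finite_weylGroup (b : P.Base) : Finite P.weylGroup := by
  refine Finite.of_injective (MulAction.toPermHom P.weylGroup ι)
    ((injective_iff_map_eq_one _).mpr fun w hw ↦ ?_)
  refine eq_one_of_smul_isPos (Φ := Set.univ) b (fun _ _ _ _ _ _ _ ↦ Set.mem_univ _)
    (by simp [weyl_univ]) fun j hj ↦ ?_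
  have : w • j = j := congrArg (fun e : Equiv.Perm ι ↦ e j) hw
  rw [this]
  exact hj.1.2

/-- The Weyl group being finite, the choice made in `longestElement` has the required property. -/
lemma isLongestIn_longest : IsLongestIn (weyl b Φ) (reflections P (simples b Φ)) (longest b Φ) := by
  have := finite_weylGroup b
  obtain ⟨w, hw, hmax⟩ := Set.exists_max_image (weyl b Φ : Set P.weylGroup)
    (wordLength (reflections P (simples b Φ))) (Set.toFinite _) ⟨1, one_mem _⟩
  exact Classical.epsilon_spec (p := IsLongestIn _ _) ⟨w, hw, hmax⟩

lemma longest_mem : longest b Φ ∈ weyl b Φ := (isLongestIn_longest b).1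

lemma longest_smul_not_isPos (hΦ : IsSubsystem P Φ) {i : ι} (hi : i ∈ posPart b Φ) :
    ¬ b.IsPos (longest b Φ • i) := by
  refine smul_not_isPos_of_simples b (fun j hj hp ↦ ?_) hi
  have hlt := ((isSignSystem b hΦ).wordLength_lt_mul_iff (i := ⟨j, hj⟩)
    (by rw [range_ofIdx_simples]; exact longest_mem b)).mpr hp
  rw [range_ofIdx_simples] at hlt
  exact hlt.not_ge ((isLongestIn_longest b).2 _
    (mul_mem (longest_mem b) (Subgroup.subset_closure ⟨j, hj, rfl⟩)))

lemma longest_smul_isPos (hΦ : IsSubsystem P Φ) {i : ι} (hi : i ∈ Φ) :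
    b.IsPos (longest b Φ • i) ↔ ¬ b.IsPos i := by
  refine ⟨fun h hp ↦ longest_smul_not_isPos b hΦ ⟨hi, hp⟩ h, fun h ↦ ?_⟩
  have := longest_smul_not_isPos b hΦ (neg_mem_posPart b hΦ hi h)
  rwa [smul_negIdx, isPos_negIdx, not_not] at this

lemma longest_smul_mem (hΦ : IsSubsystem P Φ) {i : ι} : longest b Φ • i ∈ Φ ↔ i ∈ Φ :=
  smul_mem_iff b hΦ (longest_mem b)

lemma longest_mul_self (hΦ : IsSubsystem P Φ) : longest b Φ * longest b Φ = 1 := by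
  refine eq_one_of_smul_isPos b hΦ (mul_mem (longest_mem b) (longest_mem b)) fun j hj ↦ ?_
  rw [mul_smul, longest_smul_isPos b hΦ ((longest_smul_mem b hΦ).mpr hj.1.1)]
  exact longest_smul_not_isPos b hΦ hj.1

/-- An element of `W` that carries one positive system onto another conjugates the corresponding
longest elements. -/
lemma conj_longest {Φ' : Set ι} (hΦ : IsSubsystem P Φ) (hΦ' : IsSubsystem P Φ')
    {w : P.weylGroup} (hw : ∀ i, w • i ∈ posPart b Φ' ↔ i ∈ posPart b Φ) :
    w * longest b Φ * w⁻¹ = longest b Φ' := by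
  have hmap : ∀ v ∈ weyl b Φ, w * v * w⁻¹ ∈ weyl b Φ' := by
    intro v hv
    induction hv using Subgroup.closure_induction with
    | mem x hx =>
      obtain ⟨j, hj, rfl⟩ := hx
      rw [← ofIdx_smul_eq_conj]
      exact ofIdx_mem_weyl b hΦ' ((hw j).mpr hj.1).1
    | one => simp
    | mul x y _ _ hx hy => simpa [mul_assoc] using mul_mem hx hy
    | inv x _ hx => simpa [mul_assoc] using inv_mem hx
  refine eq_of_smul_not_isPos b hΦ' (hmap _ (longest_mem b)) (longest_mem b) (fun j hj hp ↦ ?_)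
    fun j hj ↦ longest_smul_not_isPos b hΦ' hj
  have hj' : w⁻¹ • j ∈ posPart b Φ := by rw [← hw, smul_inv_smul]; exact hj
  have hneg := neg_mem_posPart b hΦ ((longest_smul_mem b hΦ).mpr hj'.1)
    (longest_smul_not_isPos b hΦ hj')
  have := ((hw _).mpr hneg).2
  rw [smul_negIdx, isPos_negIdx, ← mul_smul, ← mul_smul] at this
  exact this (by simpa [mul_assoc] using hp)

/-- If the simple roots of `Φ` are simple roots of the whole system, `W_Φ` preserves the signs
of the roots outside `Φ`. -/
lemma smul_isPos_of_notMem (hΦ : IsSubsystem P Φ) (hs : simples b Φ ⊆ b.support)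
    {w : P.weylGroup} (hw : w ∈ weyl b Φ) {i : ι} (hi : i ∉ Φ) :
    b.IsPos (w • i) ↔ b.IsPos i := by
  have key : ∀ j ∈ simples b Φ, ∀ i ∉ Φ, b.IsPos i → b.IsPos (weylGroup.ofIdx P j • i) :=
    fun j hj i hi hp ↦ hp.reflectionPerm (hs hj) (by rintro rfl; exact hi hj.1.1)
  have key' : ∀ j ∈ simples b Φ, ∀ i ∉ Φ, (b.IsPos (weylGroup.ofIdx P j • i) ↔ b.IsPos i) := by
    refine fun j hj i hi ↦ ⟨fun h ↦ ?_, key j hj i hi⟩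
    have := key j hj _ (fun hm ↦ hi
      ((hΦ.smul_mem (simples_subset b) (Subgroup.subset_closure ⟨j, hj, rfl⟩)).mp hm)) h
    rwa [smul_smul, ofIdx_mul_self, one_smul] at this
  have hw' := hw
  induction hw using Subgroup.closure_induction generalizing i with
  | mem x hx =>
    obtain ⟨j, hj, rfl⟩ := hx
    exact key' j hj i hi
  | one => simp
  | mul x y hx hy ihx ihy =>
    rw [mul_smul]
    exact (ihx (fun h ↦ hi ((smul_mem_iff b hΦ hy).mp h)) hx).trans (ihy hi hy)
  | inv x hx ihx =>
    have := ihx (fun h ↦ hi ((smul_mem_iff b hΦ (inv_mem hx)).mp h)) hx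
    rw [smul_inv_smul] at this
    exact this.symm

end Subsystems

/-! ### Spans of simple roots and restriction to `𝔞_Θ` -/

section Spans

variable {ι M N : Type*} [AddCommGroup M] [Module ℂ M] [AddCommGroup N] [Module ℂ N]
  {P : RootPairing ι ℂ M N}

open RootPairing

/-- The complex span of the roots in `X`. -/
def rootSpanOf (P : RootPairing ι ℂ M N) (X : Set ι) : Submodule ℂ M :=
  Submodule.span ℂ (P.root '' X)

/-- The roots lying in the span of the roots in `X`. -/
def spanned (P : RootPairing ι ℂ M N) (X : Set ι) : Set ι :=
  {i | P.root i ∈ rootSpanOf P X}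

lemma mem_spanned {X : Set ι} {i : ι} : i ∈ spanned P X ↔ P.root i ∈ rootSpanOf P X := Iff.rfl

lemma isSubsystem_spanned (X : Set ι) : IsSubsystem P (spanned P X) := by
  intro i hi j hj z k hk
  change P.root k ∈ rootSpanOf P X
  rw [hk]
  exact (rootSpanOf P X).add_mem hi (zsmul_mem (S := Submodule ℂ M) hj z)

lemma subset_spanned (X : Set ι) : X ⊆ spanned P X :=
  fun _ h ↦ Submodule.subset_span ⟨_, h, rfl⟩

lemma rootSpanOf_mono {X Y : Set ι} (h : X ⊆ Y) : rootSpanOf P X ≤ rootSpanOf P Y :=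
  Submodule.span_mono (Set.image_mono h)

section Restriction

variable (Θ : Set ι)

/-- Restriction of elements of `𝔥*` to `𝔞_Θ`. -/
def restrHom (P : RootPairing ι ℂ M N) (Θ : Set ι) : M →ₗ[ℂ] Module.Dual ℂ (aSpace P Θ) :=
  (aSpace P Θ).dualRestrict ∘ₗ P.toLinearMap

lemma restr_eq (i : ι) : restr P Θ i = restrHom P Θ (P.root i) := rfl

/-- By duality for a finite family of linear forms, the elements of `𝔥*` vanishing on `𝔞_Θ` are
the combinations of the roots in `Θ`. -/
lemma restrHom_eq_zero_iff [Finite ι] {m : M} : restrHom P Θ m = 0 ↔ m ∈ rootSpanOf P Θ := by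
  constructor
  · intro h
    have hker : ⨅ i : Θ, LinearMap.ker (P.root' (i : ι)) ≤ LinearMap.ker (P.toLinearMap m) := by
      intro n hn
      have hn' : n ∈ aSpace P Θ := by simpa [aSpace] using hn
      exact LinearMap.congr_fun h ⟨n, hn'⟩
    have := mem_span_of_iInf_ker_le_ker hker
    have himg : Set.range (fun i : Θ ↦ P.root' (i : ι)) = P.toLinearMap '' (P.root '' Θ) := by
      rw [← Set.image_comp, Set.image_eq_range]
      rfl
    rw [himg, Submodule.span_image] at this
    obtain ⟨m', hm', he⟩ := this
    rwa [← P.toPerfPair.injective (a₁ := m') (a₂ := m) he]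
  · intro h
    induction h using Submodule.span_induction with
    | mem x hx =>
      obtain ⟨i, hi, rfl⟩ := hx
      ext ⟨n, hn⟩
      have : n ∈ LinearMap.ker (P.root' i) := by
        simp only [aSpace, Submodule.mem_iInf] at hn
        exact hn i hi
      exact this
    | zero => simp
    | add x y _ _ hx hy => rw [map_add, hx, hy, add_zero]
    | smul c x _ hx => rw [map_smul, hx, smul_zero]

lemma mem_subDelta_iff [Finite ι] {i j : ι} :
    j ∈ subDelta P Θ i ↔ ∃ c : ℝ, P.root j - (c : ℂ) • P.root i ∈ rootSpanOf P Θ := by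
  refine exists_congr fun c ↦ ?_
  rw [restr_eq, restr_eq, ← map_smul, ← sub_eq_zero, ← map_sub, restrHom_eq_zero_iff]

lemma isSubsystem_subDelta [Finite ι] (i : ι) : IsSubsystem P (subDelta P Θ i) := by
  intro j hj k hk z l hl
  rw [mem_subDelta_iff] at *
  obtain ⟨c, hc⟩ := hj
  obtain ⟨d, hd⟩ := hk
  refine ⟨c + z * d, ?_⟩
  convert add_mem hc (zsmul_mem hd z) using 1
  rw [hl]
  push_cast
  simp only [add_smul, mul_smul, smul_sub, Int.cast_smul_eq_zsmul]
  abel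

lemma spanned_subset_subDelta [Finite ι] (i : ι) : spanned P Θ ⊆ subDelta P Θ i := fun j hj ↦ by
  rw [mem_subDelta_iff]
  exact ⟨0, by simpa [mem_spanned] using hj⟩

lemma self_mem_subDelta (i : ι) : i ∈ subDelta P Θ i := ⟨1, by simp⟩

end Restriction

variable (b : P.Base)

lemma exists_coef (k : b.support) : ∃ c : M →ₗ[ℂ] ℂ, c (P.root k) = 1 ∧
    ∀ j ∈ b.support, j ≠ k → c (P.root j) = 0 := by
  have hli : LinearIndependent ℂ (fun j : b.support ↦ P.root (j : ι)) := b.linearIndepOn_root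
  obtain ⟨c, hc⟩ := ((Module.Basis.span hli).coord k).exists_extend
  have hval (j : b.support) : c (P.root j) = (Module.Basis.span hli).coord k
      (Module.Basis.span hli j) := by
    rw [← hc]
    simp [Module.Basis.span_apply]
  refine ⟨c, by simp [hval], fun j hj hjk ↦ ?_⟩
  rw [hval ⟨j, hj⟩]
  rw [Module.Basis.coord_apply, Module.Basis.repr_self, Finsupp.single_eq_of_ne]
  exact fun h ↦ hjk (congrArg Subtype.val h.symm)

/-- The linear form giving the coefficient of the simple root `k`. -/
def coef (k : b.support) : M →ₗ[ℂ] ℂ := (exists_coef b k).choose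

lemma coef_self (k : b.support) : coef b k (P.root k) = 1 := (exists_coef b k).choose_spec.1

lemma coef_of_ne (k : b.support) {j : ι} (hj : j ∈ b.support) (hjk : j ≠ k) :
    coef b k (P.root j) = 0 := (exists_coef b k).choose_spec.2 j hj hjk

lemma coef_sum (k : b.support) (f : ι → ℤ) :
    coef b k (∑ j ∈ b.support, f j • P.root j) = f k := by
  rw [map_sum, Finset.sum_eq_single_of_mem (k : ι) k.2]
  · simp [coef_self]
  · intro j hj hjk
    simp [coef_of_ne b k hj hjk]

lemma coef_eq_zero {X : Set ι} (hX : X ⊆ b.support) {k : b.support} (hk : (k : ι) ∉ X) {m : M}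
    (hm : m ∈ rootSpanOf P X) : coef b k m = 0 := by
  refine (Submodule.span_le (p := LinearMap.ker (coef b k))).mpr ?_ hm
  rintro _ ⟨j, hj, rfl⟩
  exact coef_of_ne b k (hX hj) (by rintro rfl; exact hk hj)

lemma exists_nat_coef {i : ι} (hi : b.IsPos i) : ∃ f : ι → ℕ, f.support ⊆ b.support ∧
    P.root i = ∑ j ∈ b.support, f j • P.root j ∧ ∀ k, coef b k (P.root i) = f k := by
  obtain ⟨f, hf, hs | hs⟩ := b.exists_root_eq_sum_nat_or_neg i
  · exact ⟨f, hf, hs, fun k ↦ by rw [hs]; simpa using coef_sum b k (fun j ↦ (f j : ℤ))⟩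
  · have hs' : P.root i = ∑ j ∈ b.support, (-(f j : ℤ)) • P.root j := by simpa using hs
    have := b.isPos_iff.mp hi
    rw [b.height_eq_sum hs', Finset.sum_neg_distrib] at this
    have h0 : 0 ≤ ∑ j ∈ b.support, (f j : ℤ) := Finset.sum_nonneg fun _ _ ↦ by positivity
    omega

lemma exists_coef_ne_zero {X : Set ι} {i : ι} (hi : P.root i ∉ rootSpanOf P X) :
    ∃ k : b.support, (k : ι) ∉ X ∧ coef b k (P.root i) ≠ 0 := by
  obtain ⟨f, -, -, hs⟩ := b.exists_root_eq_sum_int i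
  by_contra! hne
  refine hi (hs ▸ sum_mem fun j hj ↦ ?_)
  by_cases hjX : j ∈ X
  · exact zsmul_mem (S := Submodule ℂ M) (subset_spanned X hjX) _
  · have := hne ⟨j, hj⟩ hjX
    rw [hs, coef_sum, Int.cast_eq_zero] at this
    simp [this]

/-- Two roots whose restrictions to `𝔞_X` are nonzero and positive multiples of each other have
the same sign. -/
lemma isPos_of_sub_mem {X : Set ι} (hX : X ⊆ b.support) {i j : ι} {c : ℝ} (hc : 0 < c)
    (hij : P.root i - (c : ℂ) • P.root j ∈ rootSpanOf P X) (hj : P.root j ∉ rootSpanOf P X)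
    (hp : b.IsPos j) : b.IsPos i := by
  obtain ⟨k, hkX, hk⟩ := exists_coef_ne_zero b hj
  have hcoef := coef_eq_zero b hX hkX hij
  obtain ⟨f, -, -, hf⟩ := exists_nat_coef b hp
  by_contra hn
  rw [← isPos_negIdx] at hn
  obtain ⟨g, -, -, hg⟩ := exists_nat_coef b hn
  have hg' := hg k
  rw [root_negIdx, map_neg, neg_eq_iff_eq_neg] at hg'
  rw [hf, Nat.cast_ne_zero] at hk
  rw [map_sub, map_smul, hg', hf, smul_eq_mul] at hcoef
  have h : -(g k : ℝ) - c * (f k : ℝ) = 0 := by exact_mod_cast hcoef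
  have : 0 < c * (f k : ℝ) := by positivity
  have : 0 ≤ (g k : ℝ) := by positivity
  linarith

lemma isPos_iff_of_sub_mem {X : Set ι} (hX : X ⊆ b.support) {i j : ι} {c : ℝ} (hc : 0 < c)
    (hij : P.root i - (c : ℂ) • P.root j ∈ rootSpanOf P X) (hj : P.root j ∉ rootSpanOf P X) :
    b.IsPos i ↔ b.IsPos j := by
  refine ⟨fun h ↦ ?_, isPos_of_sub_mem b hX hc hij hj⟩
  by_contra hn
  rw [← isPos_negIdx] at hn
  refine (isPos_negIdx b i).mp (isPos_of_sub_mem b hX hc (j := negIdx P j) ?_ ?_ hn) h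
  · rw [← neg_mem_iff]
    convert hij using 1
    simp; abel
  · rwa [root_negIdx, neg_mem_iff]

lemma isPos_iff_not_of_sub_mem {X : Set ι} (hX : X ⊆ b.support) {i j : ι} {c : ℝ} (hc : c < 0)
    (hij : P.root i - (c : ℂ) • P.root j ∈ rootSpanOf P X) (hj : P.root j ∉ rootSpanOf P X) :
    b.IsPos i ↔ ¬ b.IsPos j := by
  rw [← isPos_negIdx]
  refine isPos_iff_of_sub_mem b hX (neg_pos.mpr hc) ?_ (by rwa [root_negIdx, neg_mem_iff])
  convert hij using 1
  simp

lemma mem_simples_of_mem_support {Φ : Set ι} {k : ι} (hk : k ∈ b.support) (h : k ∈ Φ) :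
    k ∈ simples b Φ := by
  refine ⟨⟨h, b.isPos_of_mem_support hk⟩, ?_⟩
  rintro ⟨i, hi, j, hj, hij⟩
  have := b.height_add hij
  rw [b.height_one_of_mem_support hk] at this
  have := b.isPos_iff.mp hi.2
  have := b.isPos_iff.mp hj.2
  omega

lemma simples_spanned [Finite ι] [P.IsCrystallographic] {X : Set ι} (hX : X ⊆ b.support) :
    simples b (spanned P X) = X := by
  refine subset_antisymm (fun i hi ↦ ?_) fun k hk ↦
    mem_simples_of_mem_support b (hX hk) (subset_spanned X hk)
  obtain ⟨j, hjX, hji⟩ : ∃ j ∈ X, 0 < P.pairingIn ℤ j i := by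
    by_contra! hne
    obtain ⟨f, -, hf, hfc⟩ := exists_nat_coef b hi.1.2
    have hle : P.pairingIn ℤ i i ≤ 0 := by
      have : P.pairingIn ℤ i i = ∑ j ∈ b.support, f j • P.pairingIn ℤ j i := by
        apply FaithfulSMul.algebraMap_injective ℤ ℂ
        simp_rw [RootPairing.algebraMap_pairingIn, map_sum, ← RootPairing.root_coroot_eq_pairing]
        nth_rw 1 [hf]
        simp [← RootPairing.algebraMap_pairingIn P ℤ]
      rw [this]
      refine Finset.sum_nonpos fun j hj ↦ ?_
      by_cases hjX : j ∈ X
      · exact smul_nonpos_of_nonneg_of_nonpos (by positivity) (hne j hjX)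
      · have := hfc ⟨j, hj⟩
        rw [coef_eq_zero b hX hjX hi.1.1, eq_comm, Nat.cast_eq_zero] at this
        simp [this]
    simp at hle
  rw [P.zero_lt_pairingIn_iff'] at hji
  rcases eq_or_ne i j with rfl | hij
  · exact hjX
  obtain ⟨k, hk⟩ := P.root_sub_root_mem_of_pairingIn_pos hji hij
  have hj := subset_spanned (P := P) X hjX
  refine (hi.2 ⟨k, ⟨(isSubsystem_spanned X).sub_mem hi.1.1 hj hk, hi.1.2.sub (hX hjX) hk⟩, j,
    ⟨hj, b.isPos_of_mem_support (hX hjX)⟩, by rw [hk]; abel⟩).elim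

end Spans

/-! ### The elements `σ_α` -/

section Stabilizer

variable {ι M N : Type*} [AddCommGroup M] [Module ℂ M] [AddCommGroup N] [Module ℂ N]
  {P : RootPairing ι ℂ M N} (b : P.Base) (Θ : Set ι)

open RootPairing

/-- The elements of `W` that permute the positive roots of the span of `Θ`. -/
def stab : Subgroup P.weylGroup where
  carrier := {w | ∀ i, w • i ∈ posPart b (spanned P Θ) ↔ i ∈ posPart b (spanned P Θ)}
  mul_mem' {x y} hx hy i := by rw [mul_smul, hx, hy]
  one_mem' i := by rw [one_smul]
  inv_mem' {x} hx i := by rw [← hx, smul_inv_smul]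

variable {b Θ}

lemma smul_mem_posPart_iff {w : P.weylGroup} (hw : w ∈ stab b Θ) {i : ι} :
    w • i ∈ posPart b (spanned P Θ) ↔ i ∈ posPart b (spanned P Θ) := hw i

lemma smul_mem_spanned_iff {w : P.weylGroup} (hw : w ∈ stab b Θ) {i : ι} :
    w • i ∈ spanned P Θ ↔ i ∈ spanned P Θ := by
  have aux : ∀ w ∈ stab b Θ, ∀ i ∈ spanned P Θ, w • i ∈ spanned P Θ := by
    intro w hw i hi
    by_cases hp : b.IsPos i
    · exact ((hw i).mpr ⟨hi, hp⟩).1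
    · have := ((hw _).mpr (neg_mem_posPart b (isSubsystem_spanned Θ) hi hp)).1
      rw [smul_negIdx] at this
      simpa using (isSubsystem_spanned Θ).negIdx_mem this
  refine ⟨fun h ↦ ?_, aux w hw i⟩
  simpa using aux _ (inv_mem hw) _ h

/-- An element permuting the positive roots of the span of `Θ` preserves this span, and hence the
relation of having proportional restrictions to `𝔞_Θ`. -/
lemma smul_mem_rootSpanOf {w : P.weylGroup} (hw : w ∈ stab b Θ) {m : M} :
    w • m ∈ rootSpanOf P Θ ↔ m ∈ rootSpanOf P Θ := by
  have aux : ∀ w ∈ stab b Θ, ∀ m ∈ rootSpanOf P Θ, w • m ∈ rootSpanOf P Θ := by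
    intro w hw m hm
    induction hm using Submodule.span_induction with
    | mem x hx =>
      obtain ⟨i, hi, rfl⟩ := hx
      rw [← root_smul]
      exact (smul_mem_spanned_iff hw).mpr (subset_spanned Θ hi)
    | zero => simp
    | add x y _ _ hx hy => rw [smul_add]; exact add_mem hx hy
    | smul c x _ hx => rw [smul_comm]; exact Submodule.smul_mem _ _ hx
  refine ⟨fun h ↦ ?_, aux w hw m⟩
  simpa using aux _ (inv_mem hw) _ h

lemma smul_sub_mem_iff {w : P.weylGroup} (hw : w ∈ stab b Θ) {i j : ι} {c : ℂ} :
    P.root (w • i) - c • P.root (w • j) ∈ rootSpanOf P Θ ↔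
      P.root i - c • P.root j ∈ rootSpanOf P Θ := by
  rw [root_smul, root_smul, ← smul_comm w c, ← smul_sub, smul_mem_rootSpanOf hw]

/-- If `w` permutes the positive roots of the span of `Θ` and `w α > 0`, then `w` keeps all positive
roots of `Δ(α)` positive: those outside the span of `Θ` restrict to positive multiples of the
restriction of `α`. -/
lemma smul_isPos_of_subDelta [Finite ι] (hΘ : Θ ⊆ b.support) {w : P.weylGroup}
    (hw : w ∈ stab b Θ) {i : ι} (hi : P.root i ∉ rootSpanOf P Θ) (hp : b.IsPos i)
    (hwp : b.IsPos (w • i)) {j : ι} (hj : j ∈ posPart b (subDelta P Θ i)) : b.IsPos (w • j) := by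
  obtain ⟨c, hc⟩ := (mem_subDelta_iff Θ).mp hj.1
  rcases lt_trichotomy c 0 with hc0 | rfl | hc0
  · exact ((isPos_iff_not_of_sub_mem b hΘ hc0 hc hi).mp hj.2 hp).elim
  · exact ((hw j).mpr ⟨by simpa [mem_spanned] using hc, hj.2⟩).2
  · exact (isPos_iff_of_sub_mem b hΘ hc0 ((smul_sub_mem_iff hw).mpr hc)
      (by rwa [root_smul, smul_mem_rootSpanOf hw])).mpr hwp

variable [Finite ι] [P.IsCrystallographic] [P.IsReduced]

omit [P.IsReduced] in
lemma wTheta_eq (hΘ : Θ ⊆ b.support) : wTheta P Θ = longest b (spanned P Θ) := by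
  rw [wTheta, longest, weyl, simples_spanned b hΘ]

lemma sigma_eq (hΘ : Θ ⊆ b.support) (i : ι) :
    sigma P b Θ i = longest b (subDelta P Θ i) * longest b (spanned P Θ) := by
  rw [sigma, wTheta_eq hΘ, wUpper, closure_reflections b (isSubsystem_subDelta Θ i)]
  rfl

omit [P.IsCrystallographic] [P.IsReduced] in
lemma root_notMem_of_mem_ru {i : ι} (hi : i ∈ ruDeltaPos P b Θ) :
    P.root i ∉ rootSpanOf P Θ := by
  rw [← restrHom_eq_zero_iff, ← restr_eq]
  exact hi.2.2.1

omit [Finite ι] [P.IsCrystallographic] [P.IsReduced] in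
lemma sigma_mul_self {i : ι} (hi : i ∈ ruDeltaPos P b Θ) :
    sigma P b Θ i * sigma P b Θ i = 1 := by
  have h := pow_orderOf_eq_one (sigma P b Θ i)
  rwa [show orderOf (sigma P b Θ i) = 2 from hi.2.1, sq] at h

/-- As `σ_α` has order two, `w^α` and `w_Θ` commute. -/
lemma longest_commute (hΘ : Θ ⊆ b.support) {i : ι} (hi : i ∈ ruDeltaPos P b Θ) :
    sigma P b Θ i = longest b (spanned P Θ) * longest b (subDelta P Θ i) := by
  have h := sigma_mul_self hi
  rw [mul_eq_one_iff_eq_inv] at h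
  rw [h, sigma_eq hΘ, mul_inv_rev,
    inv_eq_of_mul_eq_one_left (longest_mul_self b (isSubsystem_spanned Θ)),
    inv_eq_of_mul_eq_one_left (longest_mul_self b (isSubsystem_subDelta Θ i))]

/-- A useful `σ_α` permutes the positive roots of the span of `Θ`. -/
lemma sigma_mem_stab (hΘ : Θ ⊆ b.support) {i : ι} (hi : i ∈ ruDeltaPos P b Θ) :
    sigma P b Θ i ∈ stab b Θ := by
  have key : ∀ j ∈ posPart b (spanned P Θ), sigma P b Θ i • j ∈ posPart b (spanned P Θ) := by
    intro j hj
    have hsub := isSubsystem_spanned (P := P) Θ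
    have hsubD := isSubsystem_subDelta (P := P) Θ i
    have hjD := spanned_subset_subDelta (P := P) Θ i hj.1
    have hpos : b.IsPos (sigma P b Θ i • j) := by
      rw [sigma_eq hΘ, mul_smul, longest_smul_isPos b hsubD
        (spanned_subset_subDelta Θ i ((longest_smul_mem b hsub).mpr hj.1))]
      exact longest_smul_not_isPos b hsub hj
    refine ⟨?_, hpos⟩
    -- outside the span of `Θ` the sign is not affected by `w_Θ`, and `w^α` makes `j` negative
    rw [longest_commute hΘ hi, mul_smul] at hpos ⊢
    rw [longest_smul_mem b hsub]
    by_contra hn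
    rw [smul_isPos_of_notMem b hsub (by rw [simples_spanned b hΘ]; exact hΘ) (longest_mem b) hn]
      at hpos
    exact longest_smul_not_isPos b hsubD ⟨hjD, hj.2⟩ hpos
  refine fun j ↦ ⟨fun h ↦ ?_, key j⟩
  simpa [smul_smul, sigma_mul_self hi] using key _ h

lemma sigma_mem_weyl {X : Set ι} (hΘ : Θ ⊆ b.support) (hΘX : Θ ⊆ X)
    {i : ι} (hi : P.root i ∈ rootSpanOf P X) : sigma P b Θ i ∈ weyl b (spanned P X) := by
  have hX := isSubsystem_spanned (P := P) X
  have hle : ∀ Φ ⊆ spanned P X, IsSubsystem P Φ → longest b Φ ∈ weyl b (spanned P X) := by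
    intro Φ hsub hΦ
    rw [← closure_reflections b hX]
    refine Subgroup.closure_mono (Set.image_mono hsub) ?_
    change longest b Φ ∈ Subgroup.closure (reflections P Φ)
    rw [closure_reflections b hΦ]
    exact longest_mem b
  rw [sigma_eq hΘ]
  refine mul_mem (hle _ (fun j hj ↦ ?_) (isSubsystem_subDelta Θ i))
    (hle _ (fun j hj ↦ rootSpanOf_mono hΘX hj) (isSubsystem_spanned Θ))
  obtain ⟨c, hc⟩ := (mem_subDelta_iff Θ).mp hj
  have := add_mem (rootSpanOf_mono hΘX hc) ((rootSpanOf P X).smul_mem (c : ℂ) hi)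
  rwa [sub_add_cancel] at this

end Stabilizer

section Simple

variable {ι M N : Type*} [AddCommGroup M] [Module ℂ M] [AddCommGroup N] [Module ℂ N]
  {P : RootPairing ι ℂ M N} {b : P.Base} {Θ : Set ι}
  [Finite ι] [P.IsCrystallographic] [P.IsReduced]

open RootPairing

omit [Finite ι] [P.IsCrystallographic] [P.IsReduced] in
lemma simples_subDelta {i : ι} (hi : i ∈ ruDeltaPos P b Θ) :
    simples b (subDelta P Θ i) = insert i Θ := hi.2.2.2

omit [Finite ι] [P.IsCrystallographic] [P.IsReduced] in
lemma simples_subDelta_subset (hΘ : Θ ⊆ b.support) {i : ι} (hi : i ∈ ruDeltaPos P b Θ)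
    (his : i ∈ b.support) : simples b (subDelta P Θ i) ⊆ b.support := by
  rw [simples_subDelta hi]
  exact Set.insert_subset his hΘ

lemma sigma_smul_isPos_of_notMem (hΘ : Θ ⊆ b.support) {i : ι} (hi : i ∈ ruDeltaPos P b Θ)
    (his : i ∈ b.support) {j : ι} (hj : j ∉ subDelta P Θ i) (hp : b.IsPos j) :
    b.IsPos (sigma P b Θ i • j) := by
  have hj' : j ∉ spanned P Θ := fun h ↦ hj (spanned_subset_subDelta Θ i h)
  have hsub : simples b (spanned P Θ) ⊆ b.support := by rw [simples_spanned b hΘ]; exact hΘ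
  rw [longest_commute hΘ hi, mul_smul, smul_isPos_of_notMem b (isSubsystem_spanned Θ) hsub
    (longest_mem b), smul_isPos_of_notMem b (isSubsystem_subDelta Θ i)
    (simples_subDelta_subset hΘ hi his) (longest_mem b) hj]
  · exact hp
  · exact fun h ↦ hj ((longest_smul_mem b (isSubsystem_subDelta Θ i)).mp
      (spanned_subset_subDelta Θ i h))

/-- `σ_α` sends `α` to a root with restriction a negative multiple of that of `α`. -/
lemma smul_sigma_smul_isPos (hΘ : Θ ⊆ b.support) {i : ι} (hi : i ∈ ruDeltaPos P b Θ)
    {w : P.weylGroup} (hw : w ∈ stab b Θ) :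
    b.IsPos ((w * sigma P b Θ i) • i) ↔ ¬ b.IsPos (w • i) := by
  have hsub : simples b (spanned P Θ) ⊆ b.support := by rw [simples_spanned b hΘ]; exact hΘ
  have hsubD := isSubsystem_subDelta (P := P) Θ i
  have hni := root_notMem_of_mem_ru hi
  have hσ := sigma_mem_stab hΘ hi
  have hmem : longest b (spanned P Θ) • i ∈ posPart b (subDelta P Θ i) := by
    refine ⟨?_, (smul_isPos_of_notMem b (isSubsystem_spanned Θ) hsub (longest_mem b) hni).mpr hi.1⟩
    refine (hsubD.smul_mem (X := Θ)
      ((subset_spanned Θ).trans (spanned_subset_subDelta Θ i)) ?_).mpr (self_mem_subDelta Θ i)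
    simpa only [weyl, simples_spanned b hΘ] using longest_mem b (Φ := spanned P Θ)
  have hneg : ¬ b.IsPos (sigma P b Θ i • i) := by
    rw [sigma_eq hΘ, mul_smul]
    exact longest_smul_not_isPos b hsubD hmem
  have hD : sigma P b Θ i • i ∈ subDelta P Θ i := by
    rw [sigma_eq hΘ, mul_smul]
    exact (longest_smul_mem b hsubD).mpr hmem.1
  obtain ⟨c, hc⟩ := (mem_subDelta_iff Θ).mp hD
  have hc0 : c < 0 := by
    rcases lt_trichotomy c 0 with h | rfl | h
    · exact h
    · exact (hni ((smul_mem_spanned_iff hσ).mp (by simpa [mem_spanned] using hc))).elim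
    · exact (hneg ((isPos_iff_of_sub_mem b hΘ h hc hni).mpr hi.1)).elim
  rw [mul_smul]
  exact isPos_iff_not_of_sub_mem b hΘ hc0 ((smul_sub_mem_iff hw).mpr hc)
    (by rwa [root_smul, smul_mem_rootSpanOf hw])

/-- The exchange property of the elements `σ_α`. -/
lemma sigma_exchange (hΘ : Θ ⊆ b.support) {i j : ι} (hi : i ∈ ruDeltaPos P b Θ)
    (hj : j ∈ ruDeltaPos P b Θ) (hjs : j ∈ b.support) {w : P.weylGroup} (hw : w ∈ stab b Θ)
    (hp : b.IsPos (w • i)) (hn : ¬ b.IsPos ((sigma P b Θ j * w) • i)) :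
    sigma P b Θ j * w = w * sigma P b Θ i := by
  have hni := root_notMem_of_mem_ru hi
  have hwi : w • i ∈ subDelta P Θ j := by
    by_contra h
    rw [mul_smul] at hn
    exact hn (sigma_smul_isPos_of_notMem hΘ hj hjs h hp)
  obtain ⟨c, hc⟩ := (mem_subDelta_iff Θ).mp hwi
  have hc0 : c ≠ 0 := by
    rintro rfl
    exact hni ((smul_mem_spanned_iff hw).mp (by simpa [mem_spanned] using hc))
  have hmem (k : ι) : w • k ∈ subDelta P Θ j ↔ k ∈ subDelta P Θ i := by
    simp only [mem_subDelta_iff]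
    constructor
    · rintro ⟨d, hd⟩
      refine ⟨d / c, (smul_sub_mem_iff hw).mp ?_⟩
      have := sub_mem hd ((rootSpanOf P Θ).smul_mem ((d / c : ℝ) : ℂ) hc)
      convert this using 1
      rw [smul_sub, smul_smul, ← Complex.ofReal_mul, div_mul_cancel₀ _ hc0]
      abel
    · rintro ⟨d, hd⟩
      refine ⟨d * c, ?_⟩
      have := add_mem ((smul_sub_mem_iff hw).mpr hd) ((rootSpanOf P Θ).smul_mem (d : ℂ) hc)
      convert this using 1
      rw [smul_sub, smul_smul, ← Complex.ofReal_mul]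
      abel
  have hpos (k : ι) : w • k ∈ posPart b (subDelta P Θ j) ↔ k ∈ posPart b (subDelta P Θ i) := by
    refine ⟨fun h ↦ ⟨(hmem k).mp h.1, ?_⟩,
      fun h ↦ ⟨(hmem k).mpr h.1, smul_isPos_of_subDelta hΘ hw hni hi.1 hp h⟩⟩
    by_contra hk
    have := smul_isPos_of_subDelta hΘ hw hni hi.1 hp
      (neg_mem_posPart b (isSubsystem_subDelta Θ i) ((hmem k).mp h.1) hk)
    rw [smul_negIdx, isPos_negIdx] at this
    exact this h.2
  have e1 := conj_longest b (isSubsystem_subDelta Θ i) (isSubsystem_subDelta Θ j) hpos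
  have e2 := conj_longest b (isSubsystem_spanned Θ) (isSubsystem_spanned Θ) hw
  rw [sigma_eq hΘ, sigma_eq hΘ, ← e1]
  nth_rw 1 [← e2]
  group

end Simple

/-! ### Cosets of parabolic subgroups and the Bruhat order -/

section Comparison

variable {ι M N : Type*} [AddCommGroup M] [Module ℂ M] [AddCommGroup N] [Module ℂ N]
  {P : RootPairing ι ℂ M N} {b : P.Base} {Φ : Set ι}
  [Finite ι] [P.IsCrystallographic] [P.IsReduced]

open RootPairing

omit [Finite ι] [P.IsCrystallographic] [P.IsReduced] in
lemma spanned_support (b : P.Base) : spanned P (b.support : Set ι) = Set.univ := by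
  refine Set.eq_univ_of_forall fun i ↦ ?_
  obtain ⟨f, -, -, hf⟩ := b.exists_root_eq_sum_int i
  rw [mem_spanned, hf]
  exact sum_mem fun j hj ↦ zsmul_mem (S := Submodule ℂ M) (subset_spanned _ hj) _

lemma closure_support (b : P.Base) :
    Subgroup.closure (Set.range fun j : (b.support : Set ι) ↦ weylGroup.ofIdx P (j : ι)) = ⊤ := by
  rw [← weyl_univ b, weyl, ← spanned_support b, simples_spanned b subset_rfl, reflections,
    Set.image_eq_range]

lemma isSignSystem_support (b : P.Base) :
    IsSignSystem (fun j : (b.support : Set ι) ↦ weylGroup.ofIdx P (j : ι))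
      (fun w j ↦ b.IsPos (w • (j : ι))) := by
  have := isSignSystem b (isSubsystem_spanned (P := P) (b.support : Set ι))
  rwa [simples_spanned b subset_rfl] at this

variable {x y u : P.weylGroup}

omit [Finite ι] [P.IsCrystallographic] [P.IsReduced] in
lemma range_support : Set.range (fun j : (b.support : Set ι) ↦ weylGroup.ofIdx P (j : ι)) =
    reflections P (b.support : Set ι) :=
  (Set.image_eq_range _ _).symm

/-- Induction over `W_Φ`, where `y` carries the positive roots of `Φ` to positive roots: the length
of `y * w` increases with each step. -/
lemma weyl_induction (hΦ : IsSubsystem P Φ) (hs : simples b Φ ⊆ b.support)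
    (hy : ∀ j ∈ posPart b Φ, b.IsPos (y • j)) {p : P.weylGroup → Prop} (one : p 1)
    (mul : ∀ w ∈ weyl b Φ, ∀ j ∈ simples b Φ, j ∈ b.support → b.IsPos ((y * w) • j) → p w →
      p (w * weylGroup.ofIdx P j)) (hu : u ∈ weyl b Φ) : p u := by
  refine (isSignSystem b hΦ).induction one (fun w hw j hwj hp ↦ ?_)
    (by rwa [range_ofIdx_simples])
  rw [range_ofIdx_simples] at hw
  refine mul w hw j j.2 (hs j.2) ?_ hp
  rw [mul_smul]
  exact hy _ ⟨(smul_mem_iff b hΦ hw).mpr j.2.1.1, hwj⟩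

lemma bruhatLE_mul_mul_weyl (hΦ : IsSubsystem P Φ) (hs : simples b Φ ⊆ b.support)
    (hy : ∀ j ∈ posPart b Φ, b.IsPos (y • j)) (hu : u ∈ weyl b Φ)
    (hxy : BruhatLE (reflections P (b.support : Set ι)) x y) :
    BruhatLE (reflections P (b.support : Set ι)) (x * u) (y * u) := by
  rw [← range_support] at *
  refine weyl_induction (p := fun u ↦ BruhatLE _ (x * u) (y * u)) hΦ hs hy (by simpa)
    (fun w hw j _ hj hpos ih ↦ ?_) hu
  rw [← mul_assoc, ← mul_assoc]
  exact (isSignSystem_support b).bruhatLE_mul_mul (closure_support b) ⟨j, hj⟩ ih hpos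

lemma bruhatLE_mul_weyl (hΦ : IsSubsystem P Φ) (hs : simples b Φ ⊆ b.support)
    (hy : ∀ j ∈ posPart b Φ, b.IsPos (y • j)) (hu : u ∈ weyl b Φ) :
    BruhatLE (reflections P (b.support : Set ι)) y (y * u) := by
  rw [← range_support] at *
  refine weyl_induction (p := fun u ↦ BruhatLE _ y (y * u)) hΦ hs hy (by simpa using .refl y)
    (fun w hw j _ hj hpos ih ↦ ?_) hu
  rw [← mul_assoc]
  exact ih.trans ((isSignSystem_support b).bruhatLE_mul_self (closure_support b) ⟨j, hj⟩ hpos)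

lemma wordLength_lt_mul_weyl (hΦ : IsSubsystem P Φ) (hs : simples b Φ ⊆ b.support)
    (hy : ∀ j ∈ posPart b Φ, b.IsPos (y • j)) (hu : u ∈ weyl b Φ) (hu1 : u ≠ 1) :
    wordLength (reflections P (b.support : Set ι)) y <
      wordLength (reflections P (b.support : Set ι)) (y * u) := by
  rw [← range_support] at *
  refine weyl_induction (p := fun u ↦ u ≠ 1 → wordLength _ y < wordLength _ (y * u)) hΦ hs hy
    (by simp) (fun w hw j _ hj hpos ih _ ↦ ?_) hu hu1
  have hlt := ((isSignSystem_support b).wordLength_lt_mul_iff (i := ⟨j, hj⟩)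
    (closure_support b ▸ Subgroup.mem_top (y * w))).mpr hpos
  rw [← mul_assoc]
  by_cases h1 : w = 1
  · simpa [h1] using hlt
  · exact (ih h1).trans hlt

/-- An element that carries the positive roots of `Φ` to positive roots is minimal in its coset
modulo `W_Φ`, and the projection to the minimal representatives is monotone. -/
lemma bruhatLE_of_bruhatLE_mul_weyl (hs : simples b Φ ⊆ b.support)
    (hx : ∀ j ∈ posPart b Φ, b.IsPos (x • j)) (hu : u ∈ weyl b Φ)
    (hxy : BruhatLE (reflections P (b.support : Set ι)) x (y * u)) :
    BruhatLE (reflections P (b.support : Set ι)) x y := by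
  rw [← range_support] at *
  induction hu using Subgroup.closure_induction_right with
  | one => simpa using hxy
  | mul_right w _ r hr ih =>
    obtain ⟨j, hj, rfl⟩ := hr
    rw [← mul_assoc] at hxy
    exact ih ((isSignSystem_support b).bruhatLE_of_bruhatLE_mul (closure_support b) ⟨j, hs hj⟩ hxy
      (hx j hj.1))
  | mul_inv_cancel w _ r hr ih =>
    obtain ⟨j, hj, rfl⟩ := hr
    rw [← mul_assoc, inv_eq_of_mul_eq_one_left (ofIdx_mul_self j)] at hxy
    exact ih ((isSignSystem_support b).bruhatLE_of_bruhatLE_mul (closure_support b) ⟨j, hs hj⟩ hxy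
      (hx j hj.1))

end Comparison

/-! ### Seminormal `Θ` -/

section Seminormal

variable {ι M N : Type*} [AddCommGroup M] [Module ℂ M] [AddCommGroup N] [Module ℂ N]
  {P : RootPairing ι ℂ M N} {b : P.Base} {Θ Ψ : Set ι}

open RootPairing

/-- The roots `α` defining the elements of `S(Θ)`. -/
def uBase (b : P.Base) (Θ : Set ι) : Set ι :=
  {i ∈ ruDeltaPos P b Θ | restr P Θ i ∈ uPi P b Θ}

/-- The element `σ_α` of `W(Θ)'`, for `α` in `uBase b Θ`. -/
def simpleSigma (b : P.Base) (Θ : Set ι) (i : uBase b Θ) : WPrime P b Θ :=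
  ⟨sigma P b Θ i, Subgroup.subset_closure ⟨i, i.2.1, rfl⟩⟩

lemma range_simpleSigma : Set.range (simpleSigma b Θ) = SPrime P b Θ := by
  ext w
  constructor
  · rintro ⟨i, rfl⟩
    exact ⟨i, i.2.1, i.2.2, rfl⟩
  · rintro ⟨i, hi, hi', h⟩
    exact ⟨⟨i, hi, hi'⟩, Subtype.ext h.symm⟩

/-- If `Θ` is seminormal, the roots defining `S(Θ)` are simple roots. -/
lemma uBase_eq (hΨ : Ψ ⊆ b.support)
    (hu : uPi P b Θ = restr P Θ '' (Ψ \ Θ)) : uBase b Θ = Ψ \ Θ := by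
  have key : ∀ i ∈ ruDeltaPos P b Θ, ∀ j ∈ Ψ \ Θ, restr P Θ j = restr P Θ i → j = i := by
    intro i hi j hj hji
    have hmem : j ∈ simples b (subDelta P Θ i) :=
      mem_simples_of_mem_support b (hΨ hj.1) ⟨1, by simpa using hji⟩
    rw [simples_subDelta hi] at hmem
    exact hmem.resolve_right hj.2
  ext i
  constructor
  · rintro ⟨hi, hi'⟩
    rw [hu] at hi'
    obtain ⟨j, hj, hji⟩ := hi'
    exact key i hi j hj hji ▸ hj
  · intro hi
    have hi' : restr P Θ i ∈ uPi P b Θ := hu ▸ ⟨i, hi, rfl⟩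
    obtain ⟨j, hj, hji⟩ := hi'.1
    exact ⟨key j hj i hi hji.symm ▸ hj, hi'⟩

variable [Finite ι]

/-- Every root of `ruDeltaPos` restricts to a sum of elements of the simple system `uPi`; so it lies
in the span of `Ψ`. -/
lemma root_mem_of_mem_ru (hΘ : Θ ⊆ b.support) (hΘΨ : Θ ⊆ Ψ)
    (hu : uPi P b Θ = restr P Θ '' (Ψ \ Θ)) {i : ι} (hi : i ∈ ruDeltaPos P b Θ) :
    P.root i ∈ rootSpanOf P Ψ := by
  classical
  -- the sum of the coefficients outside `Θ`; it depends only on the restriction to `𝔞_Θ`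
  let T : Finset b.support := Finset.univ.filter fun k ↦ (k : ι) ∉ Θ
  let φ : M →ₗ[ℂ] ℂ := ∑ k ∈ T, coef b k
  have hφ0 {m : M} (hm : m ∈ rootSpanOf P Θ) : φ m = 0 := by
    rw [LinearMap.sum_apply]
    exact Finset.sum_eq_zero fun k hk ↦ coef_eq_zero b hΘ (Finset.mem_filter.mp hk).2 hm
  have hφ {i : ι} (hi : i ∈ ruDeltaPos P b Θ) : ∃ n : ℕ, φ (P.root i) = n ∧ 0 < n := by
    obtain ⟨f, -, -, hf⟩ := exists_nat_coef b hi.1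
    refine ⟨∑ k ∈ T, f k, ?_, ?_⟩
    · rw [LinearMap.sum_apply, Nat.cast_sum]
      exact Finset.sum_congr rfl fun k _ ↦ hf k
    · obtain ⟨k, hk, hk0⟩ := exists_coef_ne_zero b (X := Θ) (i := i) fun h ↦ hi.2.2.1 (by
        rwa [restr_eq, restrHom_eq_zero_iff])
      rw [hf, Nat.cast_ne_zero] at hk0
      exact Finset.sum_pos' (fun _ _ ↦ Nat.zero_le _)
        ⟨k, by simpa [T] using hk, Nat.pos_of_ne_zero hk0⟩
  obtain ⟨n, hn, -⟩ := hφ hi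
  induction n using Nat.strong_induction_on generalizing i with
  | _ n ih =>
    by_cases hiu : restr P Θ i ∈ uPi P b Θ
    · rw [hu] at hiu
      obtain ⟨j, hj, hji⟩ := hiu
      rw [restr_eq, restr_eq, eq_comm, ← sub_eq_zero, ← map_sub, restrHom_eq_zero_iff] at hji
      have := add_mem (rootSpanOf_mono hΘΨ hji) (subset_spanned (P := P) Ψ hj.1)
      rwa [sub_add_cancel] at this
    · obtain ⟨_, ⟨j, hj, rfl⟩, _, ⟨k, hk, rfl⟩, hjk⟩ : ∃ γ₁ ∈ ruSigmaPos P b Θ,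
          ∃ γ₂ ∈ ruSigmaPos P b Θ, restr P Θ i = γ₁ + γ₂ := by
        by_contra hne
        exact hiu ⟨⟨i, hi, rfl⟩, hne⟩
      rw [restr_eq, restr_eq, restr_eq, ← map_add, ← sub_eq_zero, ← map_sub,
        restrHom_eq_zero_iff] at hjk
      obtain ⟨nj, hnj, hnj0⟩ := hφ hj
      obtain ⟨nk, hnk, hnk0⟩ := hφ hk
      have hsum := hφ0 hjk
      rw [map_sub, map_add, hn, hnj, hnk, sub_eq_zero] at hsum
      have hsum' : n = nj + nk := by exact_mod_cast hsum
      have := add_mem (rootSpanOf_mono hΘΨ hjk)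
        (add_mem (ih nj (by omega) hj hnj) (ih nk (by omega) hk hnk))
      rwa [sub_add_cancel] at this

variable [P.IsCrystallographic] [P.IsReduced]

lemma sigma_mem_weyl_subDelta (hΘ : Θ ⊆ b.support) (i : ι) :
    sigma P b Θ i ∈ weyl b (subDelta P Θ i) := by
  rw [sigma_eq hΘ]
  refine mul_mem (longest_mem b) ?_
  rw [← closure_reflections b (isSubsystem_subDelta Θ i)]
  refine Subgroup.closure_mono (Set.image_mono ?_) (longest_mem b)
  exact (simples_subset b).trans (spanned_subset_subDelta Θ i)

omit [Finite ι] [P.IsCrystallographic] [P.IsReduced] in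
lemma sigma_ne_one {i : ι} (hi : i ∈ ruDeltaPos P b Θ) : sigma P b Θ i ≠ 1 := by
  intro h
  have : orderOf (sigma P b Θ i) = 2 := hi.2.1
  simp [h] at this

/-- The elements of `W_Ψ` permuting the positive roots of the span of `Θ` are products of elements
`σ_α` with `α` in `Ψ \ Θ`: the length is decreased on multiplication by `σ_α` if `α` is sent to a
negative root. -/
lemma exists_mem_closure_of_mem_stab (hΘ : Θ ⊆ b.support) (hΘΨ : Θ ⊆ Ψ) (hΨ : Ψ ⊆ b.support)
    (hE : uBase b Θ = Ψ \ Θ) {w : P.weylGroup} (hw : w ∈ weyl b (spanned P Ψ))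
    (hw' : w ∈ stab b Θ) :
    w ∈ (Subgroup.closure (Set.range (simpleSigma b Θ))).map (WPrime P b Θ).subtype := by
  induction hn : wordLength (reflections P (b.support : Set ι)) w using Nat.strong_induction_on
    generalizing w with
  | _ n ih =>
    by_cases hpos : ∀ j ∈ Ψ, b.IsPos (w • j)
    · rw [eq_one_of_smul_isPos b (isSubsystem_spanned Ψ) hw (by rwa [simples_spanned b hΨ])]
      exact one_mem _
    · push Not at hpos
      obtain ⟨i, hiΨ, hi⟩ := hpos
      have hiΘ : i ∉ Θ := fun h ↦ hi
        ((smul_mem_posPart_iff hw').mpr ⟨subset_spanned Θ h, b.isPos_of_mem_support (hΘ h)⟩).2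
      have hiE : i ∈ uBase b Θ := hE ▸ ⟨hiΨ, hiΘ⟩
      have hσ := sigma_mem_stab hΘ hiE.1
      have hw2 : w * sigma P b Θ i ∈ stab b Θ := mul_mem hw' hσ
      have hlt := wordLength_lt_mul_weyl (y := w * sigma P b Θ i) (isSubsystem_subDelta Θ i)
        (simples_subDelta_subset hΘ hiE.1 (hΨ hiΨ)) (fun j hj ↦ smul_isPos_of_subDelta hΘ hw2
          (root_notMem_of_mem_ru hiE.1) hiE.1.1 ((smul_sigma_smul_isPos hΘ hiE.1 hw').mpr hi) hj)
        (sigma_mem_weyl_subDelta hΘ i) (sigma_ne_one hiE.1)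
      have e : w * sigma P b Θ i * sigma P b Θ i = w := by
        rw [mul_assoc, sigma_mul_self hiE.1, mul_one]
      rw [e, hn] at hlt
      have := mul_mem (ih _ hlt (mul_mem hw (sigma_mem_weyl hΘ hΘΨ (subset_spanned Ψ hiΨ))) hw2
        rfl) (show sigma P b Θ i ∈ _ from
          ⟨simpleSigma b Θ ⟨i, hiE⟩, Subgroup.subset_closure ⟨_, rfl⟩, rfl⟩)
      rwa [e] at this

lemma wPrime_le_stab (hΘ : Θ ⊆ b.support) : WPrime P b Θ ≤ stab b Θ := by
  rw [WPrime, Subgroup.closure_le]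
  rintro _ ⟨i, hi, rfl⟩
  exact sigma_mem_stab hΘ hi

lemma closure_simpleSigma (hΘ : Θ ⊆ b.support) (hΘΨ : Θ ⊆ Ψ) (hΨ : Ψ ⊆ b.support)
    (hu : uPi P b Θ = restr P Θ '' (Ψ \ Θ)) :
    Subgroup.closure (Set.range (simpleSigma b Θ)) = ⊤ := by
  have hle : WPrime P b Θ ≤ weyl b (spanned P Ψ) := by
    rw [WPrime, Subgroup.closure_le]
    rintro _ ⟨i, hi, rfl⟩
    exact sigma_mem_weyl hΘ hΘΨ (root_mem_of_mem_ru hΘ hΘΨ hu hi)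
  rw [eq_top_iff]
  rintro w -
  obtain ⟨v, hv, hvw⟩ := exists_mem_closure_of_mem_stab hΘ hΘΨ hΨ (uBase_eq hΨ hu) (hle w.2)
    (wPrime_le_stab hΘ w.2)
  rwa [← Subtype.ext (show (v : P.weylGroup) = w from hvw)]

/-- `W(Θ)'` with the generators `σ_α` obeys the combinatorics of a Coxeter group, the sign attached
to `w` and `σ_α` being that of `w α`. -/
lemma isSignSystem_simpleSigma (hΘ : Θ ⊆ b.support) (hE : uBase b Θ ⊆ b.support) :
    IsSignSystem (simpleSigma b Θ)
      (fun w i ↦ b.IsPos ((w : P.weylGroup) • (i : ι))) where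
  mul_self i := Subtype.ext (sigma_mul_self i.2.1)
  pos_one i := by simpa using i.2.1.1
  pos_mul_self w _ i := smul_sigma_smul_isPos hΘ i.2.1 (wPrime_le_stab hΘ w.2)
  exchange w _ i j hp hn := Subtype.ext
    (sigma_exchange hΘ i.2.1 j.2.1 (hE j.2) (wPrime_le_stab hΘ w.2) hp hn)

/-- For seminormal `Θ` the Bruhat order of `(W(Θ)', S(Θ))` is induced by that of `(W, S)`. -/
lemma bruhatLE_coe_iff (hΘ : IsSeminormal P b Θ) (x y : WPrime P b Θ) :
    BruhatLE (reflections P (b.support : Set ι)) (x : P.weylGroup) (y : P.weylGroup) ↔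
      BruhatLE (SPrime P b Θ) x y := by
  obtain ⟨⟨hs, -⟩, Ψ, hΘΨ, hΨ, hu⟩ := hΘ
  have hE : uBase b Θ ⊆ b.support := by
    rw [uBase_eq hΨ hu]
    exact Set.sdiff_subset.trans hΨ
  have hsign := isSignSystem_simpleSigma hs hE
  have htop := closure_simpleSigma hs hΘΨ hΨ hu
  rw [← range_simpleSigma]
  have hpos {w : WPrime P b Θ} {i : uBase b Θ} (h : b.IsPos ((w : P.weylGroup) • (i : ι))) :
      ∀ j ∈ posPart b (subDelta P Θ i), b.IsPos ((w : P.weylGroup) • j) := fun j hj ↦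
    smul_isPos_of_subDelta hs (wPrime_le_stab hs w.2) (root_notMem_of_mem_ru i.2.1) i.2.1.1 h hj
  have hsub (i : uBase b Θ) := isSubsystem_subDelta (P := P) Θ (i : ι)
  have hsimp (i : uBase b Θ) := simples_subDelta_subset hs i.2.1 (hE i.2)
  have hσ (i : uBase b Θ) := sigma_mem_weyl_subDelta (b := b) hs (i : ι)
  have hy : y ∈ Subgroup.closure (Set.range (simpleSigma b Θ)) := htop ▸ Subgroup.mem_top y
  revert x
  refine hsign.induction (p := fun y ↦ ∀ x : WPrime P b Θ,
    BruhatLE _ (x : P.weylGroup) (y : P.weylGroup) ↔ BruhatLE _ x y) (fun x ↦ ?_)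
    (fun y _ i hyi ih x ↦ ⟨fun hxy ↦ ?_, fun hxy ↦ ?_⟩) hy
  · constructor
    · intro hx
      rw [← range_support] at hx
      have := (isSignSystem_support b).eq_one_of_bruhatLE_one (closure_support b) hx
      rw [show x = 1 from Subtype.ext this]
      exact .refl 1
    · intro hx
      rw [hsign.eq_one_of_bruhatLE_one htop hx]
      exact .refl _
  · by_cases hxi : b.IsPos ((x : P.weylGroup) • (i : ι))
    · -- `x` is minimal in its coset, so it lies below the minimal representative `y` of `y * σ`
      exact ((ih x).mp (bruhatLE_of_bruhatLE_mul_weyl (hsimp i) (hpos hxi) (hσ i)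
        hxy)).trans (hsign.bruhatLE_mul_self htop i hyi)
    · -- here the minimal representative of the coset of `x` is `x * σ`
      have hxi' := (hsign.pos_mul_self x (htop ▸ Subgroup.mem_top x) i).mpr hxi
      have hle : BruhatLE (reflections P (b.support : Set ι))
          ((x * simpleSigma b Θ i : WPrime P b Θ) : P.weylGroup) x := by
        have := bruhatLE_mul_weyl (hsub i) (hsimp i) (hpos hxi') (hσ i)
        rwa [show ((x * simpleSigma b Θ i : WPrime P b Θ) : P.weylGroup) * sigma P b Θ i = x from
          congrArg Subtype.val (hsign.mul_mul_self x i)] at this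
      have := hsign.bruhatLE_mul_mul htop i ((ih _).mp (bruhatLE_of_bruhatLE_mul_weyl
        (hsimp i) (hpos hxi') (hσ i) (hle.trans hxy))) hyi
      rwa [hsign.mul_mul_self] at this
  · have hcases := hsign.bruhatLE_or_of_bruhatLE htop i hxy
    rw [hsign.mul_mul_self] at hcases
    rcases hcases with h | h
    · exact ((ih x).mpr h).trans (bruhatLE_mul_weyl (hsub i) (hsimp i) (hpos hyi) (hσ i))
    · have := bruhatLE_mul_mul_weyl (hsub i) (hsimp i) (hpos hyi) (hσ i) ((ih _).mpr h)
      rwa [show ((x * simpleSigma b Θ i : WPrime P b Θ) : P.weylGroup) * sigma P b Θ i = x from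
        congrArg Subtype.val (hsign.mul_mul_self x i)] at this

end Seminormal

end UsefulRoots

end

theorem theorem3p4p5 {ι M N : Type*} [Finite ι] [AddCommGroup M] [Module ℂ M]
    [AddCommGroup N] [Module ℂ N] (P : RootPairing ι ℂ M N) [P.IsCrystallographic] [P.IsReduced]
    (b : P.Base) (Θ : Set ι) (hΘ : UsefulRoots.IsSeminormal P b Θ)
    (x y : UsefulRoots.WPrime P b Θ) :
    BruhatLE (UsefulRoots.reflections P (b.support : Set ι)) (x : P.weylGroup) (y : P.weylGroup) ↔
      BruhatLE (UsefulRoots.SPrime P b Θ) x y := 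
  UsefulRoots.bruhatLE_coe_iff hΘ x y
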